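/- Let $X$ be a compact complex manifold of dimension $n\ge 1$ with a Kähler form $\omega$ (positive in the sense $\omega(v,Jv)>0$ for $v\neq 0$), and let $(E,h)$ be a smooth Hermitian complex vector bundle of finite rank over $X$. Let $\mathcal A(E,h)$ be the space of smooth unitary connections on $(E,h)$, an affine space over the real vector space $\Omega^1(\mathrm{End}_{SH}(E,h))$ of smooth $1$-forms with values in the skew-Hermitian endomorphisms, which is its tangent space at every point, with the almost complex structure $\mathbb J(a)=-ia^{1,0}+ia^{0,1}$. On the pullback $\mathcal E$ of $E$ to $\mathcal A(E,h)\times X$ consider the universal connection $$(D_{\mathcal E}s)(u,v)=(ds)(u)+(D_As)(v),\qquad (u,v)\in T_{(A,x)}(\mathcal A(E,h)\times X),$$ with curvature $F_{D_{\mathcal E}}$, and define the $2$-form $\Omega$ on $\mathcal A(E,h)$ by the fibre integral $$\Omega=-\frac12\int_{\mathcal A(E,h)\times X/\mathcal A(E,h)}\operatorname{tr}\Big(\frac1{2!}\Big(\frac{i}{2\pi}F_{D_{\mathcal E}}\Big)^2\Big)\wedge\omega^{n-1}.$$ Here wedge products of forms are normalised by $\alpha\wedge\beta=\frac1{p!\,q!}\sum_\sigma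 \mathrm{sgn}(\sigma)\,\alpha(v_{\sigma(1)},\dots,v_{\sigma(p)})\,\beta(v_{\sigma(p+1)},\dots,v_{\sigma(p+q)})$. Then for every $A\in\mathcal A(E,h)$ and all $a,b\in T_A\mathcal A(E,h)\cong\Omega^1(\mathrm{End}_{SH}(E,h))$, $$\Omega(a,b)=-\frac{1}{8\pi^2}\int_X\operatorname{tr}(a\wedge b)\wedge\omega^{n-1},$$ which is the Atiyah–Bott/Donaldson form; and $\Omega$ is a Kähler form on $(\mathcal A(E,h),\mathbb J)$: $\mathbb J^2=-\mathrm{Id}$, and $\Omega$ is a smooth closed real $2$-form with $\Omega(\mathbb Ja,\mathbb Jb)=\Omega(a,b)$ and $\Omega(a,\mathbb Ja)>0$ for $a\neq0$. (Equivalently, the fibre integral without the factor $-\tfrac12$ equals $\frac1{4\pi^2}\int_X\operatorname{tr}(a\wedge b)\wedge\omega^{n-1}$.) -/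

import Mathlib

open Bundle Manifold Filter Set Topology MeasureTheory
open scoped ContDiff

noncomputable section

/-- The model space `ℂⁿ` of an `n`-dimensional complex manifold. -/
abbrev Cn (n : ℕ) : Type := Fin n → ℂ

section ComplexManifold

variable {n : ℕ} {X : Type*} [TopologicalSpace X] [ChartedSpace (Cn n) X]

/-- A complex manifold is in particular a smooth real manifold (with the same charts). -/
instance realManifoldOfComplex [IsManifold 𝓘(ℂ, Cn n) ∞ X] : IsManifold 𝓘(ℝ, Cn n) ∞ X :=
  isManifold_of_contDiffOn _ _ _ fun _ _ he he' =>
    ((contDiffGroupoid ∞ 𝓘(ℂ, Cn n)).compatible he he').1.restrict_scalars ℝ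

/-- The real tangent space of a complex manifold of dimension `n`. -/
abbrev RTan (n : ℕ) {X : Type*} [TopologicalSpace X] [ChartedSpace (Cn n) X] (x : X) : Type :=
  TangentSpace 𝓘(ℝ, Cn n) x

/-- The complex structure of the tangent space: multiplication by `i` in the preferred
holomorphic chart at `x`. -/
def tanJ (x : X) : RTan n x →L[ℝ] RTan n x :=
  (Complex.I • ContinuousLinearMap.id ℝ (Cn n) : Cn n →L[ℝ] Cn n)

/-- The vector field `V` is smooth at `x`. -/
abbrev SmoothFieldAt [IsManifold 𝓘(ℝ, Cn n) ∞ X] (V : ∀ y : X, RTan n y) (x : X) : Prop :=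
  ContMDiffAt 𝓘(ℝ, Cn n) (𝓘(ℝ, Cn n).prod 𝓘(ℝ, Cn n)) ∞
    (fun y => (TotalSpace.mk' (Cn n) y (V y) : TangentBundle 𝓘(ℝ, Cn n) X)) x

theorem tanJ_smoothFieldAt [IsManifold 𝓘(ℂ, Cn n) ∞ X] {V : ∀ y : X, RTan n y} {x : X}
    (hV : SmoothFieldAt V x) : SmoothFieldAt (fun y => tanJ y (V y)) x := by
  have h1 := (contMDiffAt_section (F := Cn n) (E := (TangentSpace 𝓘(ℝ, Cn n) : X → Type _))
    x).1 hV
  refine (contMDiffAt_section (F := Cn n) (E := (TangentSpace 𝓘(ℝ, Cn n) : X → Type _)) x).2 ?_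
  have h2 : ContMDiffAt 𝓘(ℝ, Cn n) 𝓘(ℝ, Cn n) ∞ (fun y : X => Complex.I •
      (trivializationAt (Cn n) (TangentSpace 𝓘(ℝ, Cn n) : X → Type _) x ⟨y, V y⟩).2) x :=
    ((Complex.I • ContinuousLinearMap.id ℝ (Cn n) : Cn n →L[ℝ] Cn n).contMDiff.contMDiffAt).comp
      x h1
  refine h2.congr_of_eventuallyEq ?_
  filter_upwards [(chartAt (Cn n) x).open_source.mem_nhds (mem_chart_source (Cn n) x)] with y hy
  have hd : DifferentiableAt ℂ (extChartAt 𝓘(ℂ, Cn n) x ∘ (extChartAt 𝓘(ℂ, Cn n) y).symm)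
      (extChartAt 𝓘(ℂ, Cn n) y y) := by
    have := (contDiffWithinAt_ext_coord_change (I := 𝓘(ℂ, Cn n)) (n := ∞) (M := X) x y
      (y := extChartAt 𝓘(ℂ, Cn n) y y) (by simp [hy])).differentiableWithinAt (by simp)
    rw [modelWithCornersSelf_coe, range_id] at this
    exact differentiableWithinAt_univ.1 this
  have h3 : ∀ v : Cn n, tangentCoordChange 𝓘(ℝ, Cn n) y x y v =
      fderiv ℂ (extChartAt 𝓘(ℂ, Cn n) x ∘ (extChartAt 𝓘(ℂ, Cn n) y).symm)
        (extChartAt 𝓘(ℂ, Cn n) y y) v := by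
    intro v
    rw [tangentCoordChange_def]
    have := hd.fderiv_restrictScalars ℝ
    simp only [modelWithCornersSelf_coe, range_id, fderivWithin_univ]
    exact congrArg (fun L : Cn n →L[ℝ] Cn n => L v) this
  change tangentCoordChange 𝓘(ℝ, Cn n) y x y (Complex.I • (show Cn n from V y)) =
    Complex.I • tangentCoordChange 𝓘(ℝ, Cn n) y x y (show Cn n from V y)
  rw [h3, h3]
  exact map_smul _ _ _

/-- The inverse of the preferred chart at `i`, as a parametrisation of part of `X`. -/
abbrev chartParam (n : ℕ) {X : Type*} [TopologicalSpace X] [ChartedSpace (Cn n) X] (i : X) :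
    Cn n → X :=
  (extChartAt 𝓘(ℝ, Cn n) i).symm

/-- The differential of the inverse of the preferred chart at `i`. -/
abbrev chartParamDeriv (n : ℕ) {X : Type*} [TopologicalSpace X] [ChartedSpace (Cn n) X] (i : X)
    (y : Cn n) : Cn n →L[ℝ] RTan n (chartParam n i y) :=
  mfderiv 𝓘(ℝ, Cn n) 𝓘(ℝ, Cn n) (chartParam n i) y

/-- The coordinate expression, in the chart at `i`, of a real 2-form on `X`. -/
def formInChart (κ : ∀ x : X, RTan n x [⋀^Fin 2]→L[ℝ] ℝ) (i : X) (y : Cn n) :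
    Cn n [⋀^Fin 2]→L[ℝ] ℝ :=
  (κ (chartParam n i y)).compContinuousLinearMap (chartParamDeriv n i y)

variable (n X) in
/-- A Kähler form on the complex manifold `X`: a smooth closed real 2-form which is invariant
under the complex structure and positive, `κ(v, Jv) > 0` for `v ≠ 0`. -/
structure KahlerForm where
  form : ∀ x : X, RTan n x [⋀^Fin 2]→L[ℝ] ℝ
  smooth : ∀ i : X, ContDiffOn ℝ ∞ (formInChart form i) (extChartAt 𝓘(ℝ, Cn n) i).target
  closed : ∀ i : X, ∀ y ∈ (extChartAt 𝓘(ℝ, Cn n) i).target, extDeriv (formInChart form i) y = 0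
  invariant : ∀ (x : X) (v w : RTan n x), form x ![tanJ x v, tanJ x w] = form x ![v, w]
  positive : ∀ (x : X) (v : RTan n x), v ≠ 0 → 0 < form x ![v, tanJ x v]

end ComplexManifold

section Forms

/-! Forms of degree `p` at a point, with values in a possibly noncommutative algebra `R`, are
treated as functions of `p` tangent vectors. -/

/-- The wedge product of alternating forms of degrees `p` and `q`, with the usual normalisation
`(α ∧ β)(v) = 1/(p! q!) ∑_σ sgn(σ) α(v_σ(1), …, v_σ(p)) β(v_σ(p+1), …, v_σ(p+q))`. -/
def wedge {T R : Type*} [Ring R] [Algebra ℂ R] {p q : ℕ} (α : (Fin p → T) → R)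
    (β : (Fin q → T) → R) : (Fin (p + q) → T) → R :=
  fun v => ((p.factorial * q.factorial : ℂ))⁻¹ • ∑ σ : Equiv.Perm (Fin (p + q)),
    (Equiv.Perm.sign σ : ℤ) •
      (α (fun i => v (σ (Fin.castAdd q i))) * β (fun j => v (σ (Fin.natAdd p j))))

/-- The `k`-th wedge power of a scalar 2-form. -/
def wedgePow {T : Type*} (α : (Fin 2 → T) → ℂ) : (k : ℕ) → (Fin (2 * k) → T) → ℂ
  | 0 => fun _ => 1
  | k + 1 => wedge (wedgePow α k) α

end Forms

section Integration

variable {n : ℕ} {X : Type*} [TopologicalSpace X] [ChartedSpace (Cn n) X]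

/-- The standard positively oriented real frame `e₁, i e₁, e₂, i e₂, …` of `ℂⁿ`. -/
def stdFrame (n : ℕ) (k : Fin (2 * n)) : Cn n :=
  Pi.single ⟨k / 2, by omega⟩ (if (k : ℕ) % 2 = 0 then 1 else Complex.I)

variable [IsManifold 𝓘(ℂ, Cn n) ∞ X] [T2Space X] [CompactSpace X]

variable (n X) in
/-- A smooth partition of unity on `X` subordinate to the cover by the preferred charts. -/
def chartPartition : SmoothPartitionOfUnity X 𝓘(ℝ, Cn n) X univ :=
  (SmoothPartitionOfUnity.exists_isSubordinate_chartAt_source 𝓘(ℝ, Cn n) X).choose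

/-- The integral over `X`, with its complex orientation, of a form of top degree `2n`: cut the form
off by a partition of unity subordinate to the charts and integrate the coordinate expressions
against Lebesgue measure. -/
def integralTop (η : ∀ x : X, (Fin (2 * n) → RTan n x) → ℂ) : ℂ :=
  ∑ᶠ i : X, ∫ y in (extChartAt 𝓘(ℝ, Cn n) i).target,
    ((chartPartition n X i (chartParam n i y) : ℝ) : ℂ) *
      η (chartParam n i y) (fun k => chartParamDeriv n i y (stdFrame n k))

end Integration

section HermitianBundle

variable {n : ℕ} {X : Type*} [TopologicalSpace X] [ChartedSpace (Cn n) X]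
  [IsManifold 𝓘(ℂ, Cn n) ∞ X]
  {F : Type*} [NormedAddCommGroup F] [NormedSpace ℂ F]
  {E : X → Type*} [∀ x, AddCommGroup (E x)] [∀ x, Module ℂ (E x)] [∀ x, TopologicalSpace (E x)]
  [∀ x, IsTopologicalAddGroup (E x)] [∀ x, ContinuousSMul ℝ (E x)]
  [TopologicalSpace (TotalSpace F E)] [FiberBundle F E]
  [VectorBundle ℂ F E] [VectorBundle ℝ F E] [ContMDiffVectorBundle ∞ F E 𝓘(ℝ, Cn n)]

variable (n F) in
/-- The section `s` is smooth at `x`. -/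
abbrev SmoothSecAt (s : ∀ y : X, E y) (x : X) : Prop :=
  ContMDiffAt 𝓘(ℝ, Cn n) (𝓘(ℝ, Cn n).prod 𝓘(ℝ, F)) ∞ (fun y => TotalSpace.mk' F y (s y)) x

variable (n F) in
/-- The section `s` is differentiable at `x`. -/
abbrev DiffSecAt (s : ∀ y : X, E y) (x : X) : Prop :=
  MDifferentiableAt 𝓘(ℝ, Cn n) (𝓘(ℝ, Cn n).prod 𝓘(ℝ, F)) (fun y => TotalSpace.mk' F y (s y)) x

theorem diffSecAt_I_smul {s : ∀ y : X, E y} {x : X} (hs : DiffSecAt n F s x) :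
    DiffSecAt n F (fun y => Complex.I • s y) x := by
  refine (mdifferentiableAt_section 𝓘(ℝ, Cn n) _).2 ?_
  have h1 := (mdifferentiableAt_section 𝓘(ℝ, Cn n) _).1 hs
  have h2 : MDifferentiableAt 𝓘(ℝ, Cn n) 𝓘(ℝ, F)
      (fun y : X => Complex.I • (trivializationAt F E x ⟨y, s y⟩).2) x :=
    ((Complex.I • ContinuousLinearMap.id ℝ F : F →L[ℝ] F).mdifferentiableAt).comp x h1
  refine h2.congr_of_eventuallyEq ?_
  filter_upwards [(trivializationAt F E x).open_baseSet.mem_nhds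
    (mem_baseSet_trivializationAt F E x)] with y hy
  exact ((trivializationAt F E x).linear ℂ hy).map_smul _ _

variable (n F E) in
/-- A smooth Hermitian metric on the complex vector bundle `E` (conjugate linear in the first
argument). -/
structure HermitianMetric where
  inner : ∀ x : X, E x →ₗ⋆[ℂ] E x →ₗ[ℂ] ℂ
  conj_symm : ∀ (x : X) (e f : E x), starRingEnd ℂ (inner x e f) = inner x f e
  positive : ∀ (x : X) (e : E x), e ≠ 0 → 0 < (inner x e e).re
  smooth : ∀ (s t : ∀ y : X, E y) (x : X), SmoothSecAt n F s x → SmoothSecAt n F t x →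
    ContMDiffAt 𝓘(ℝ, Cn n) 𝓘(ℝ, ℂ) ∞ (fun y => inner y (s y) (t y)) x

/-- A smooth unitary connection on the Hermitian vector bundle `(E, h)`. The values on sections
which are not differentiable at the point in question carry no information; they are normalised to
be `0`, so that a connection is determined by its action on smooth sections. -/
structure UnitaryConnection (h : HermitianMetric n F E) extends
    CovariantDerivative 𝓘(ℝ, Cn n) F E where
  complex_linear : ∀ (s : ∀ y : X, E y) (x : X), DiffSecAt n F s x → ∀ v : RTan n x,
    toFun (fun y => Complex.I • s y) x v = Complex.I • toFun s x v
  unitary : ∀ (s t : ∀ y : X, E y) (x : X), DiffSecAt n F s x → DiffSecAt n F t x →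
    ∀ v : RTan n x, mvfderiv 𝓘(ℝ, Cn n) (fun y => h.inner y (s y) (t y)) x v =
      h.inner x (toFun s x v) (t x) + h.inner x (s x) (toFun t x v)
  smooth : ∀ (s : ∀ y : X, E y) (V : ∀ y : X, RTan n y) (x : X), SmoothSecAt n F s x →
    SmoothFieldAt V x → SmoothSecAt n F (fun y => toFun s y (V y)) x
  normalised : ∀ (s : ∀ y : X, E y) (x : X), ¬ DiffSecAt n F s x → toFun s x = 0

/-- The real vector space `Ω¹(End_SH(E, h))` of smooth 1-forms with values in the skew-Hermitian
endomorphisms of `(E, h)`. -/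
def SHForm (h : HermitianMetric n F E) :
    Submodule ℝ (∀ x : X, RTan n x →ₗ[ℝ] Module.End ℂ (E x)) where
  carrier := {a | (∀ (x : X) (v : RTan n x) (e f : E x),
      h.inner x (a x v e) f + h.inner x e (a x v f) = 0) ∧
    ∀ (s : ∀ y : X, E y) (V : ∀ y : X, RTan n y) (x : X), SmoothSecAt n F s x →
      SmoothFieldAt V x → SmoothSecAt n F (fun y => a y (V y) (s y)) x}
  zero_mem' := by
    refine ⟨fun x v e f => by simp, fun s V x hs hV => ?_⟩
    exact contMDiffAt_zeroSection ℝ E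
  add_mem' := by
    rintro a b ⟨ha, ha'⟩ ⟨hb, hb'⟩
    refine ⟨fun x v e f => ?_, fun s V x hs hV => ?_⟩
    · have h1 := ha x v e f
      have h2 := hb x v e f
      simp only [Pi.add_apply, LinearMap.add_apply, map_add]
      linear_combination h1 + h2
    · exact (ha' s V x hs hV).add_section (hb' s V x hs hV)
  smul_mem' := by
    rintro c a ⟨ha, ha'⟩
    refine ⟨fun x v e f => ?_, fun s V x hs hV => ?_⟩
    · have h1 := ha x v e f
      have h2 : ∀ e' : E x, c • e' = (c : ℂ) • e' := fun e' => (Complex.coe_smul c e').symm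
      simp only [Pi.smul_apply, LinearMap.smul_apply, h2, map_smulₛₗ, Complex.conj_ofReal,
        smul_eq_mul, RingHom.id_apply]
      linear_combination (c : ℂ) * h1
    · exact (ha' s V x hs hV).const_smul_section (a := c)

variable {h : HermitianMetric n F E}

/-- The 1-form `v ↦ a(v) s` with values in `E`. -/
def SHForm.app (a : SHForm h) (s : ∀ y : X, E y) (x : X) : RTan n x →L[ℝ] E x :=
  have : T2Space (RTan n x) := inferInstanceAs (T2Space (Cn n))
  have : FiniteDimensional ℝ (RTan n x) := inferInstanceAs (FiniteDimensional ℝ (Cn n))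
  LinearMap.toContinuousLinearMap
    { toFun := fun v => a.1 x v (s x)
      map_add' := fun v w => by simp
      map_smul' := fun c v => by simp }

theorem SHForm.app_apply (a : SHForm h) (s : ∀ y : X, E y) (x : X) (v : RTan n x) :
    SHForm.app a s x v = a.1 x v (s x) := rfl

open Classical in
/-- The space `𝒜(E, h)` of unitary connections is an affine space over `Ω¹(End_SH(E, h))`: the
connection `A + a` is `s ↦ D_A s + a s`. -/
instance : VAdd (SHForm h) (UnitaryConnection h) where
  vadd a A :=
    { toFun := fun s x => if DiffSecAt n F s x then A.toFun s x + SHForm.app a s x else 0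
      isCovariantDerivativeOnUniv :=
        { add := by
            intro s t x hs ht _
            have hst := mdifferentiableAt_add_section hs ht
            rw [if_pos hst, if_pos hs, if_pos ht,
              A.isCovariantDerivativeOnUniv.add hs ht]
            ext v
            simp [SHForm.app_apply]
            abel
          leibniz := by
            intro s g x hs hg _
            have hgs := hg.smul_section hs
            rw [if_pos hgs, if_pos hs, A.isCovariantDerivativeOnUniv.leibniz hs hg]
            ext v
            simp [SHForm.app_apply]
            abel }
      complex_linear := by
        intro s x hs v
        rw [if_pos hs, if_pos (diffSecAt_I_smul hs)]
        simp only [add_apply, SHForm.app_apply, smul_add, A.complex_linear s x hs v, map_smul]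
      unitary := by
        intro s t x hs ht v
        have h1 := A.unitary s t x hs ht v
        have h2 := a.2.1 x v (s x) (t x)
        simp only [if_pos hs, if_pos ht, add_apply, SHForm.app_apply, map_add,
          LinearMap.add_apply]
        linear_combination h1 - h2
      smooth := by
        intro s V x hs hV
        refine ((A.smooth s V x hs hV).add_section (a.2.2 s V x hs hV)).congr_of_eventuallyEq ?_
        have h1 : ∀ᶠ y in 𝓝 x, DiffSecAt n F s y := by
          have : ContMDiffVectorBundle 1 F E 𝓘(ℝ, Cn n) := .of_le (n := ∞) (by norm_num)
          have : IsManifold 𝓘(ℝ, Cn n) 1 X := .of_le (n := ∞) (by norm_num)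
          have h2 := (contMDiffAt_iff_contMDiffAt_nhds (n := 1) (by simp)).1
            (ContMDiffAt.of_le (m := 1) hs (by norm_num))
          filter_upwards [h2] with y hy
          exact hy.mdifferentiableAt (by simp)
        filter_upwards [h1] with y hy
        simp [if_pos hy, SHForm.app_apply]
      normalised := fun s x hs => if_neg hs }

open Classical in
theorem UnitaryConnection.vadd_apply (a : SHForm h) (A : UnitaryConnection h)
    {s : ∀ y : X, E y} {x : X} (hs : DiffSecAt n F s x) (v : RTan n x) :
    (a +ᵥ A).toFun s x v = A.toFun s x v + a.1 x v (s x) := by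
  change (if DiffSecAt n F s x then A.toFun s x + SHForm.app a s x else 0) v = _
  rw [if_pos hs]; rfl

/-- The `(1,0)`-part `a^{1,0}(v) = (a(v) - i a(Jv)) / 2` of `a`. -/
def SHForm.part10 (a : SHForm h) (x : X) (v : RTan n x) : Module.End ℂ (E x) :=
  (1 / 2 : ℂ) • (a.1 x v - Complex.I • a.1 x (tanJ x v))

/-- The `(0,1)`-part `a^{0,1}(v) = (a(v) + i a(Jv)) / 2` of `a`. -/
def SHForm.part01 (a : SHForm h) (x : X) (v : RTan n x) : Module.End ℂ (E x) :=
  (1 / 2 : ℂ) • (a.1 x v + Complex.I • a.1 x (tanJ x v))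

theorem SHForm.complexStructure_eq (a : SHForm h) (x : X) (v : RTan n x) :
    -Complex.I • SHForm.part10 a x v + Complex.I • SHForm.part01 a x v = -a.1 x (tanJ x v) := by
  have hI : Complex.I * Complex.I = -1 := Complex.I_mul_I
  simp only [SHForm.part10, SHForm.part01]
  match_scalars <;> ring_nf <;> simp

variable (h) in
/-- The complex structure `𝕁(a) = -i a^{1,0} + i a^{0,1}` on `Ω¹(End_SH(E, h))`, the tangent space
of `𝒜(E, h)` at each of its points. -/
def complexStructure : SHForm h →ₗ[ℝ] SHForm h where
  toFun a := ⟨fun x =>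
    { toFun := fun v => -Complex.I • SHForm.part10 a x v + Complex.I • SHForm.part01 a x v
      map_add' := fun v w => by
        simp only [SHForm.complexStructure_eq, map_add, neg_add]
      map_smul' := fun c v => by
        simp only [SHForm.complexStructure_eq, map_smul, smul_neg, RingHom.id_apply] }, by
    refine ⟨fun x v e f => ?_, fun s V x hs hV => ?_⟩
    · have h1 := a.2.1 x (tanJ x v) e f
      simp only [LinearMap.coe_mk, AddHom.coe_mk, SHForm.complexStructure_eq, LinearMap.neg_apply,
        map_neg]
      linear_combination -h1
    · have h1 := (a.2.2 s _ x hs (tanJ_smoothFieldAt hV)).neg_section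
      simpa only [LinearMap.coe_mk, AddHom.coe_mk, SHForm.complexStructure_eq,
        LinearMap.neg_apply, SmoothSecAt] using! h1⟩
  map_add' a b := by
    ext x v e
    change (-Complex.I • SHForm.part10 (a + b) x v + Complex.I • SHForm.part01 (a + b) x v) e =
      (-Complex.I • SHForm.part10 a x v + Complex.I • SHForm.part01 a x v) e +
        (-Complex.I • SHForm.part10 b x v + Complex.I • SHForm.part01 b x v) e
    simp only [SHForm.complexStructure_eq]
    simp
    abel
  map_smul' c a := by
    ext x v e
    change (-Complex.I • SHForm.part10 (c • a) x v + Complex.I • SHForm.part01 (c • a) x v) e =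
      c • (-Complex.I • SHForm.part10 a x v + Complex.I • SHForm.part01 a x v) e
    simp only [SHForm.complexStructure_eq]
    simp

/-- The universal connection `D_ℰ` on the pullback `ℰ` of `E` to `𝒜(E, h) × X`: for a section `S`
of `ℰ` and a tangent vector `u = (a, v)` at `(A, x)`,
`(D_ℰ S)(a, v) = (dS)(a) + (D_A S)(v)`. -/
def universalConnection (S : UnitaryConnection h → ∀ y : X, E y) (A : UnitaryConnection h) (x : X)
    (u : SHForm h × RTan n x) : E x :=
  deriv (fun t : ℝ => S (t • u.1 +ᵥ A) x) 0 + A.toFun (S A) x u.2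

/-- The curvature `F(u, w) = D_U D_W - D_W D_U - D_{[U, W]}` of the universal connection at `(A, x)`.
The tangent vectors `u = (a, v)`, `w = (b, w')` are extended to the vector fields `U`, `W` on
`𝒜(E, h) × X` that are constant along the affine space `𝒜(E, h)` and smooth near `x` along `X`, so
that `[U, W] = (0, [V, W'])`; the vectors of a basis of `E x` are extended to sections of `ℰ` that
are constant along `𝒜(E, h)` and smooth near `x`. -/
def universalCurvature (A : UnitaryConnection h) (x : X) (u w : SHForm h × RTan n x) :
    Module.End ℂ (E x) :=
  let V : ∀ y : X, RTan n y := FiberBundle.extend (Cn n) u.2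
  let W : ∀ y : X, RTan n y := FiberBundle.extend (Cn n) w.2
  let b := Module.Basis.ofVectorSpace ℂ (E x)
  b.constr ℂ fun i =>
    let s : UnitaryConnection h → ∀ y : X, E y := fun _ => FiberBundle.extend F (b i)
    universalConnection (fun A' y => universalConnection s A' y (w.1, W y)) A x u
      - universalConnection (fun A' y => universalConnection s A' y (u.1, V y)) A x w
      - universalConnection s A x (0, VectorField.mlieBracket 𝓘(ℝ, Cn n) V W x)

/-- The 4-form `tr((1/2!) ((i/2π) F)²)` on `𝒜(E, h) × X`, `F` the curvature of the universal
connection. -/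
def universalChernForm (A : UnitaryConnection h) (x : X) :
    (Fin (2 + 2) → SHForm h × RTan n x) → ℂ :=
  let c : (Fin 2 → SHForm h × RTan n x) → Module.End ℂ (E x) := fun w =>
    (Complex.I / (2 * (Real.pi : ℂ))) • universalCurvature A x (w 0) (w 1)
  fun w => LinearMap.trace ℂ (E x) ((1 / (Nat.factorial 2 : ℂ)) • wedge c c w)

/-- The 2-form `tr(a ∧ b)` on `X`. -/
def traceWedge (a b : SHForm h) (x : X) : (Fin (1 + 1) → RTan n x) → ℂ :=
  fun v => LinearMap.trace ℂ (E x)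
    (wedge (fun v : Fin 1 → RTan n x => a.1 x (v 0)) (fun v => b.1 x (v 0)) v)

variable [T2Space X] [CompactSpace X]

/-- The fibre integral, along `𝒜(E, h) × X → 𝒜(E, h)`, of a form of degree `p + 2n`. -/
def fibreIntegral {p : ℕ}
    (η : UnitaryConnection h → ∀ x : X, (Fin (p + 2 * n) → SHForm h × RTan n x) → ℂ)
    (A : UnitaryConnection h) (a : Fin p → SHForm h) : ℂ :=
  integralTop fun x v => η A x (Fin.append (fun i => (a i, 0)) (fun j => (0, v j)))

theorem degree_eq₁ (n : ℕ) [NeZero n] : 2 + 2 + 2 * (n - 1) = 2 + 2 * n := by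
  have := NeZero.pos n; omega

theorem degree_eq₂ (n : ℕ) [NeZero n] : 1 + 1 + 2 * (n - 1) = 2 * n := by
  have := NeZero.pos n; omega

variable [NeZero n] (κ : KahlerForm n X)

/-- The fibre integral `∫ tr((1/2!) ((i/2π) F)²) ∧ κ^{n-1}` over `𝒜(E, h) × X → 𝒜(E, h)`. -/
def fibreChernForm (A : UnitaryConnection h) (a : Fin 2 → SHForm h) : ℂ :=
  fibreIntegral (p := 2) (fun A' x w =>
    wedge (universalChernForm A' x)
      (wedgePow (fun w' : Fin 2 → SHForm h × RTan n x =>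
        (κ.form x (fun i => (w' i).2) : ℂ)) (n - 1))
      (fun i => w (Fin.cast (degree_eq₁ n) i))) A a

/-- `∫_X tr(a ∧ b) ∧ κ^{n-1}`. -/
def traceIntegral (a b : SHForm h) : ℂ :=
  integralTop fun x v =>
    wedge (traceWedge a b x) (wedgePow (fun w : Fin 2 → RTan n x => (κ.form x w : ℂ)) (n - 1))
      (fun i => v (Fin.cast (degree_eq₂ n) i))

end HermitianBundle

section Kahler

/-- `K` is a Kähler form on the affine space `𝒜` over the real vector space `T`, with respect to
the translation invariant (hence integrable) almost complex structure `J`: it is a smooth closed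
real 2-form, `J`-invariant, and `g(a, b) = K(a, Jb)` is positive definite. Smoothness is tested on
finite-dimensional affine subspaces; the three terms in `closed` make up `(dK)(a, b, c)`. -/
structure IsKahlerForm {𝒜 T : Type*} [AddCommGroup T] [Module ℝ T] [VAdd T 𝒜] (J : T →ₗ[ℝ] T)
    (K : 𝒜 → T [⋀^Fin 2]→ₗ[ℝ] ℝ) : Prop where
  almost_complex : ∀ a : T, J (J a) = -a
  smooth : ∀ (A : 𝒜) (k : ℕ) (c : Fin k → T) (a : Fin 2 → T),
    ContDiff ℝ ∞ (fun t : Fin k → ℝ => K ((∑ i, t i • c i) +ᵥ A) a)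
  closed : ∀ (A : 𝒜) (a b c : T),
    deriv (fun t : ℝ => K (t • a +ᵥ A) ![b, c]) 0 - deriv (fun t : ℝ => K (t • b +ᵥ A) ![a, c]) 0
      + deriv (fun t : ℝ => K (t • c +ᵥ A) ![a, b]) 0 = 0
  invariant : ∀ (A : 𝒜) (a b : T), K A ![J a, J b] = K A ![a, b]
  positive : ∀ (A : 𝒜) (a : T), a ≠ 0 → 0 < K A ![a, J a]

end Kahler

end

/-! Why it holds. The universal connection is trivial along the affine space of connections, so its
curvature has no component on two vertical vectors, and its mixed component on `(a, 0)` and `(0, v)`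
is the derivative of `t ↦ D_{A+ta}` in the direction `v`, that is `a(v)`
(`universalCurvature_vertical`, `universalCurvature_mixed`). Contracting `tr(½((i/2π)F)²)` with two
vertical vectors therefore never meets the curvature of `A` itself, and leaves `(1/4π²) tr(a ∧ b)`
(`universalChernForm_contract`). The pullback of the Kähler form is killed by vertical vectors, so
contraction passes through the wedge product (`wedge_cons`), and the fibre integral is `(1/4π²)∫
tr(a ∧ b) ∧ κ^{n-1}` (`fibreChernForm_eq`). It does not depend on `A`, which makes smoothness and
closedness immediate.

The other Kähler properties are pointwise on `X`. Traces of products of skew-Hermitian endomorphisms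
are real. Since `𝕁a = -a ∘ J`, replacing `a, b` by `𝕁a, 𝕁b` moves the arguments of the top form by
`J`, whose real determinant is `|iⁿ|² = 1` (`traceTop_complexStructure`). For positivity, `β = -tr(a
∧ 𝕁a)` satisfies `β(v, Jv) = -tr a(v)² - tr a(Jv)² ≥ 0`. In a complex basis diagonalising `κ`, the
expansion of `β ∧ κ^{n-1}` over permutations has only nonnegative terms (`pairs_term_nonneg`), and
some term is positive where `a ≠ 0`. Any other complex frame changes the value by a factor `|det|²`
(`AlternatingMap.map_complexLinear`), so the sign is the same in every holomorphic chart. Continuity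
in the charts then turns pointwise positivity into positivity of the integral
(`integralTop_re_pos`). -/

noncomputable section

set_option linter.unusedSectionVars false

/-! ### Wedge products as sums over permutations; contraction with a vector. -/

section WedgeAlgebra

open Equiv

variable {T R : Type*} [Ring R] [Algebra ℂ R]

/-- The unnormalised antisymmetrisation `∑_σ sgn(σ) Φ(v_σ(1), …, v_σ(N))`. -/
def altSum {N : ℕ} (Φ : (Fin N → T) → R) (v : Fin N → T) : R :=
  ∑ σ : Perm (Fin N), (Perm.sign σ : ℤ) • Φ (fun i => v (σ i))

/-- The tensor product of two functions of several vectors. -/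
def tensorMul {p q : ℕ} (α : (Fin p → T) → R) (β : (Fin q → T) → R) (v : Fin (p + q) → T) : R :=
  α (fun i => v (Fin.castAdd q i)) * β (fun j => v (Fin.natAdd p j))

theorem wedge_eq_altSum {p q : ℕ} (α : (Fin p → T) → R) (β : (Fin q → T) → R)
    (v : Fin (p + q) → T) :
    wedge α β v = ((p.factorial * q.factorial : ℂ))⁻¹ • altSum (tensorMul α β) v := rfl

theorem altSum_perm {N : ℕ} (Φ : (Fin N → T) → R) (v : Fin N → T) (τ : Perm (Fin N)) :
    altSum Φ (fun i => v (τ i)) = (Perm.sign τ : ℤ) • altSum Φ v := by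
  unfold altSum
  rw [Finset.smul_sum]
  refine Fintype.sum_equiv (Equiv.mulLeft τ) _ _ fun σ => ?_
  have h : (Perm.sign τ : ℤ) * (Perm.sign τ : ℤ) = 1 := by
    rw [← Units.val_mul, Int.units_mul_self, Units.val_one]
  simp only [Equiv.coe_mulLeft, Perm.sign_mul, Units.val_mul, smul_smul, Perm.mul_apply]
  rw [← mul_assoc, h, one_mul]

theorem wedge_perm {p q : ℕ} (α : (Fin p → T) → R) (β : (Fin q → T) → R) (v : Fin (p + q) → T)
    (τ : Perm (Fin (p + q))) :
    wedge α β (fun i => v (τ i)) = (Perm.sign τ : ℤ) • wedge α β v := by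
  rw [wedge_eq_altSum, wedge_eq_altSum, altSum_perm, smul_comm]

/-- Permutations of the two blocks of arguments combine to one permutation of all arguments, and
right translation by it only reindexes the antisymmetrisation. -/
theorem altSum_tensorMul_perm {p q : ℕ} (α : (Fin p → T) → R) (β : (Fin q → T) → R)
    (τ : Perm (Fin p)) (ρ : Perm (Fin q)) (v : Fin (p + q) → T) :
    altSum (tensorMul (fun w => α (fun i => w (τ i))) (fun w => β (fun i => w (ρ i)))) v =
      (Perm.sign τ * Perm.sign ρ : ℤ) • altSum (tensorMul α β) v := by
  set κ : Perm (Fin (p + q)) := finSumFinEquiv.permCongr (sumCongr τ ρ)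
  have hκ : Perm.sign κ = Perm.sign τ * Perm.sign ρ := by
    rw [Perm.sign_permCongr, Perm.sign_sumCongr]
  unfold altSum
  rw [Finset.smul_sum]
  refine Fintype.sum_equiv (Equiv.mulRight κ) _ _ fun σ => ?_
  have h1 : ∀ i, κ (Fin.castAdd q i) = Fin.castAdd q (τ i) := fun i => by
    simp [κ, Equiv.permCongr_apply]
  have h2 : ∀ i, κ (Fin.natAdd p i) = Fin.natAdd p (ρ i) := fun i => by
    simp [κ, Equiv.permCongr_apply]
  have h : ((Perm.sign τ * Perm.sign ρ : ℤ)) * (Perm.sign τ * Perm.sign ρ : ℤ) = 1 := by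
    rw [← Units.val_mul, ← Units.val_mul, Int.units_mul_self, Units.val_one]
  simp only [Equiv.coe_mulRight, Perm.sign_mul, hκ, Units.val_mul, smul_smul, Perm.mul_apply,
    tensorMul, h1, h2]
  congr 1
  linear_combination -(Perm.sign σ : ℤ) * h

theorem altSum_finset_sum {N : ℕ} {ι : Type*} (s : Finset ι) (Φ : ι → (Fin N → T) → R)
    (v : Fin N → T) :
    altSum (fun w => ∑ i ∈ s, Φ i w) v = ∑ i ∈ s, altSum (Φ i) v := by
  unfold altSum
  simp_rw [Finset.smul_sum]
  exact Finset.sum_comm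

theorem altSum_zsmul {N : ℕ} (c : ℤ) (Φ : (Fin N → T) → R) (v : Fin N → T) :
    altSum (fun w => c • Φ w) v = c • altSum Φ v := by
  unfold altSum
  rw [Finset.smul_sum]
  exact Finset.sum_congr rfl fun σ _ => smul_comm _ _ _

theorem altSum_smul {N : ℕ} (c : ℂ) (Φ : (Fin N → T) → R) (v : Fin N → T) :
    altSum (fun w => c • Φ w) v = c • altSum Φ v := by
  unfold altSum
  rw [Finset.smul_sum]
  exact Finset.sum_congr rfl fun σ _ => smul_comm _ _ _

theorem sign_mul_self_zsmul {N : ℕ} (σ : Perm (Fin N)) (r : R) :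
    (Perm.sign σ : ℤ) • (Perm.sign σ : ℤ) • r = r := by
  rw [smul_smul, ← Units.val_mul, Int.units_mul_self, Units.val_one, one_smul]

/-- Each permutation inside the inner antisymmetrisation is absorbed by the outer one, its sign
cancelling; this leaves `p!` equal copies. It is what flattens iterated wedge products into a single
sum. -/
theorem altSum_tensorMul_altSum_left {p q : ℕ} (Φ : (Fin p → T) → R) (Ψ : (Fin q → T) → R)
    (v : Fin (p + q) → T) :
    altSum (tensorMul (altSum Φ) Ψ) v = p.factorial • altSum (tensorMul Φ Ψ) v := by
  have h : tensorMul (altSum Φ) Ψ = fun w => ∑ τ : Perm (Fin p), (Perm.sign τ : ℤ) •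
      tensorMul (fun w => Φ (fun i => w (τ i))) (fun w => Ψ (fun i => w ((1 : Perm (Fin q)) i)))
        w := by
    funext w
    simp only [tensorMul, altSum, Finset.sum_mul, smul_mul_assoc, Perm.one_apply]
  rw [h, altSum_finset_sum]
  simp_rw [altSum_zsmul, altSum_tensorMul_perm, Perm.sign_one, Units.val_one, mul_one,
    sign_mul_self_zsmul]
  simp [Fintype.card_perm]

theorem altSum_tensorMul_altSum_right {p q : ℕ} (Φ : (Fin p → T) → R) (Ψ : (Fin q → T) → R)
    (v : Fin (p + q) → T) :
    altSum (tensorMul Φ (altSum Ψ)) v = q.factorial • altSum (tensorMul Φ Ψ) v := by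
  have h : tensorMul Φ (altSum Ψ) = fun w => ∑ τ : Perm (Fin q), (Perm.sign τ : ℤ) •
      tensorMul (fun w => Φ (fun i => w ((1 : Perm (Fin p)) i))) (fun w => Ψ (fun i => w (τ i)))
        w := by
    funext w
    simp only [tensorMul, altSum, Finset.mul_sum, mul_smul_comm, Perm.one_apply]
  rw [h, altSum_finset_sum]
  simp_rw [altSum_zsmul, altSum_tensorMul_perm, Perm.sign_one, Units.val_one, one_mul,
    sign_mul_self_zsmul]
  simp [Fintype.card_perm]

/-- Splitting a sum over permutations according to the preimage of `0`. -/
theorem sum_perm_succ {M : Type*} [AddCommMonoid M] {N : ℕ} (f : Perm (Fin (N + 1)) → M) :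
    ∑ σ, f σ = ∑ k : Fin (N + 1), ∑ e : Perm (Fin N),
      f (Perm.decomposeFin.symm (0, e) * swap 0 k) := by
  rw [← Fintype.sum_prod_type']
  symm
  refine Fintype.sum_equiv ((Equiv.prodCongr (Equiv.refl _) (Equiv.inv _)).trans
    (Perm.decomposeFin.symm.trans (Equiv.inv _))) _ _ ?_
  rintro ⟨k, e⟩
  congr 1
  have h1 : ∀ k : Fin (N + 1), ∀ e : Perm (Fin N), Perm.decomposeFin.symm (k, e) =
      swap 0 k * Perm.decomposeFin.symm (0, e) := by
    intro k e
    ext i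
    refine Fin.cases ?_ (fun j => ?_) i <;> simp [Perm.mul_apply]
  have h2 : (Perm.decomposeFin.symm (0, e⁻¹))⁻¹ = Perm.decomposeFin.symm (0, e) := by
    rw [inv_eq_iff_mul_eq_one]
    ext i
    refine Fin.cases ?_ (fun j => ?_) i <;> simp [Perm.mul_apply]
  simp only [Equiv.trans_apply, Equiv.prodCongr_apply, Equiv.inv_apply, Prod.map_apply,
    Equiv.refl_apply]
  rw [h1 k, mul_inv_rev, h2, swap_inv]

/-- Contraction of a wedge product with a vector on which the second factor vanishes. -/
theorem wedge_cons {p q : ℕ} {α : (Fin (p + 1) → T) → R} {β : (Fin q → T) → R} {u : T}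
    (hα : ∀ (τ : Perm (Fin (p + 1))) v, α (fun i => v (τ i)) = (Perm.sign τ : ℤ) • α v)
    (hβ : ∀ v j, v j = u → β v = 0) (h : p + 1 + q = p + q + 1) (w : Fin (p + q) → T) :
    wedge α β (fun i => (Fin.cons u w : Fin (p + q + 1) → T) (Fin.cast h i)) =
      wedge (fun v => α (Fin.cons u v)) β w := by
  set L : Fin (p + 1) → Fin (p + q + 1) := fun i => Fin.cast h (Fin.castAdd q i)
  set S : Fin q → Fin (p + q + 1) := fun j => Fin.cast h (Fin.natAdd (p + 1) j)
  have hL0 : L 0 = 0 := by ext; simp [L]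
  have hLs : ∀ i : Fin p, L i.succ = (Fin.castAdd q i).succ := fun i => by ext; simp [L]
  have hS : ∀ j, S j = (Fin.natAdd p j).succ := fun j => by ext; simp [S]; omega
  have hLi : Function.Injective L := fun i j hij => by
    simpa [L] using hij
  have hSL : ∀ i j, S j ≠ L i := fun i j hij => by
    have := congrArg Fin.val hij
    simp [L, S] at this; omega
  have hSi : ∀ j, S j ≠ 0 := fun j => hL0 ▸ hSL 0 j
  set W : Fin (p + q + 1) → T := Fin.cons u w
  set f : Perm (Fin (p + q + 1)) → R := fun σ => (Perm.sign σ : ℤ) •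
    (α (fun i => W (σ (L i))) * β (fun j => W (σ (S j))))
  have hf : altSum (tensorMul α β) (fun i => W (Fin.cast h i)) = ∑ σ, f σ := by
    refine Fintype.sum_equiv (finCongr h).permCongr _ _ fun σ => ?_
    simp only [f, Perm.sign_permCongr, Equiv.permCongr_apply]
    rfl
  -- If `u` lands in a slot of the first factor, antisymmetry of `α` moves it to slot `0`; the sign
  -- of the transposition cancels the one in the permutation.
  have hE : ∀ (e : Perm (Fin (p + q))) (i : Fin (p + 1)),
      f (Perm.decomposeFin.symm (0, e) * swap 0 (L i)) = f (Perm.decomposeFin.symm (0, e)) := by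
    intro e i
    have h1 : ∀ i', swap 0 (L i) (L i') = L (swap 0 i i') := fun i' => by
      rw [← hL0, hLi.swap_apply]
    have h2 : ∀ j, swap 0 (L i) (S j) = S j := fun j =>
      swap_apply_of_ne_of_ne (hSi j) (hSL i j)
    have h3 : Perm.sign (swap 0 (L i)) = Perm.sign (swap 0 i) := by
      by_cases hi : i = 0
      · simp [hi, hL0]
      · rw [Perm.sign_swap (Ne.symm hi), Perm.sign_swap]
        exact fun h' => hi (hLi (hL0.trans h')).symm
    simp only [f, Perm.mul_apply, h1, h2, Perm.sign_mul, Units.val_mul, h3]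
    rw [hα (swap 0 i) (fun i' => W (Perm.decomposeFin.symm (0, e) (L i'))), smul_mul_assoc,
      smul_smul, mul_assoc, ← Units.val_mul, Int.units_mul_self, Units.val_one, mul_one]
  -- If `u` lands in a slot of the second factor, `β` vanishes.
  have hZ : ∀ (e : Perm (Fin (p + q))) (j : Fin q),
      f (Perm.decomposeFin.symm (0, e) * swap 0 (S j)) = 0 := by
    intro e j
    have : β (fun j' => W ((Perm.decomposeFin.symm (0, e) * swap 0 (S j)) (S j'))) = 0 := by
      refine hβ _ j ?_
      simp [Perm.mul_apply, W]
    simp only [f, this, mul_zero, smul_zero]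
  have hsum : ∑ σ, f σ = (p + 1) • altSum (tensorMul (fun v => α (Fin.cons u v)) β) w := by
    rw [sum_perm_succ]
    have h1 : ∀ g : Fin (p + q + 1) → R, ∑ k, g k = ∑ i, g (L i) + ∑ j, g (S j) := by
      intro g
      rw [← Fin.sum_univ_add (f := fun i => g (Fin.cast h i))]
      exact (Fintype.sum_equiv (finCongr h) _ _ fun _ => rfl).symm
    rw [h1]
    simp only [hE, hZ, Finset.sum_const_zero, add_zero, Finset.sum_const, Finset.card_univ,
      Fintype.card_fin]
    congr 1
    refine Finset.sum_congr rfl fun e _ => ?_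
    simp only [f, tensorMul, hS, Perm.decomposeFin.symm_sign, if_true, one_mul]
    congr 2
    · congr 1
      funext i
      refine Fin.cases ?_ (fun j => ?_) i
      · simp [hL0, W]
      · simp [hLs, W]
  -- The `p + 1` equal terms turn the normalisation `1/(p+1)!` into `1/p!`.
  rw [wedge_eq_altSum, hf, hsum, wedge_eq_altSum, ← Nat.cast_smul_eq_nsmul ℂ, smul_smul]
  congr 1
  have h1 : ((p + 1 : ℕ) : ℂ) ≠ 0 := Nat.cast_ne_zero.2 (Nat.succ_ne_zero p)
  have h2 : (p.factorial : ℂ) ≠ 0 := Nat.cast_ne_zero.2 p.factorial_ne_zero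
  have h3 : (q.factorial : ℂ) ≠ 0 := Nat.cast_ne_zero.2 q.factorial_ne_zero
  rw [Nat.factorial_succ, Nat.cast_mul]
  field_simp

theorem wedge_congr_left {p q : ℕ} {α α' : (Fin p → T) → R} {β : (Fin q → T) → R}
    {v : Fin (p + q) → T} (h : ∀ σ : Fin p → Fin (p + q), α (fun i => v (σ i)) =
      α' (fun i => v (σ i))) : wedge α β v = wedge α' β v := by
  unfold wedge
  congr 1
  refine Finset.sum_congr rfl fun σ _ => ?_
  rw [h (fun i => σ (Fin.castAdd q i))]

theorem wedge_const_smul_left {p q : ℕ} (c : ℂ) (α : (Fin p → T) → R) (β : (Fin q → T) → R)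
    (v : Fin (p + q) → T) : wedge (fun w => c • α w) β v = c • wedge α β v := by
  have h : tensorMul (fun w => c • α w) β = fun w => c • tensorMul α β w :=
    funext fun w => smul_mul_assoc _ _ _
  rw [wedge_eq_altSum, wedge_eq_altSum, smul_comm, h, altSum_smul]

theorem wedgePow_comp {T' : Type*} (g : T' → T) (α : (Fin 2 → T) → ℂ) (k : ℕ)
    (v : Fin (2 * k) → T') :
    wedgePow (fun w => α (fun i => g (w i))) k v = wedgePow α k (fun i => g (v i)) := by
  induction k with
  | zero => rfl
  | succ k ih =>
    have : wedgePow (fun w => α (fun i => g (w i))) k =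
        fun w => wedgePow α k (fun i => g (w i)) := funext ih
    simp only [wedgePow, this]
    rfl

/-- A wedge power of a 2-form vanishes as soon as one of its arguments is in the kernel. -/
theorem wedgePow_eq_zero {α : (Fin 2 → T) → ℂ} {u : T} (hα : ∀ v j, v j = u → α v = 0) (k : ℕ)
    (v : Fin (2 * k) → T) (j : Fin (2 * k)) (hj : v j = u) : wedgePow α k v = 0 := by
  induction k with
  | zero => exact j.elim0
  | succ k ih =>
    change wedge (wedgePow α k) α v = 0
    rw [wedge_eq_altSum, altSum, Finset.sum_eq_zero, smul_zero]
    intro σ _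
    obtain ⟨i, rfl⟩ := σ.surjective j
    unfold tensorMul
    refine Fin.addCases (motive := fun i => v (σ i) = u → _) (fun l hl => ?_) (fun l hl => ?_) i hj
    · rw [ih _ l hl, zero_mul, smul_zero]
    · rw [hα _ l hl, mul_zero, smul_zero]

theorem wedge_one_one (α β : T → R) (v : Fin 2 → T) :
    wedge (p := 1) (q := 1) (fun w => α (w 0)) (fun w => β (w 0)) v =
      α (v 0) * β (v 1) - α (v 1) * β (v 0) := by
  have h : (Finset.univ : Finset (Perm (Fin (1 + 1)))) = {1, swap 0 1} := by decide
  unfold wedge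
  rw [h, Finset.sum_pair (by decide), Perm.sign_one, Perm.sign_swap (by decide)]
  simp [Fin.natAdd, sub_eq_add_neg]

theorem sum_perm_fin_four {M : Type*} [AddCommGroup M] (G : Fin 4 → Fin 4 → Fin 4 → Fin 4 → M) :
    ∑ σ : Perm (Fin 4), (Perm.sign σ : ℤ) • G (σ 0) (σ 1) (σ 2) (σ 3) =
      G 0 1 2 3 - G 0 1 3 2 - G 0 2 1 3 + G 0 2 3 1 + G 0 3 1 2 - G 0 3 2 1
      - G 1 0 2 3 + G 1 0 3 2 + G 1 2 0 3 - G 1 2 3 0 - G 1 3 0 2 + G 1 3 2 0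
      + G 2 0 1 3 - G 2 0 3 1 - G 2 1 0 3 + G 2 1 3 0 + G 2 3 0 1 - G 2 3 1 0
      - G 3 0 1 2 + G 3 0 2 1 + G 3 1 0 2 - G 3 1 2 0 - G 3 2 0 1 + G 3 2 1 0 := by
  have key : ∀ {N : ℕ} (f : Perm (Fin (N + 1)) → M),
      ∑ σ, f σ = ∑ k : Fin (N + 1), ∑ e : Perm (Fin N), f (Perm.decomposeFin.symm (k, e)) := by
    intro N f
    rw [← Fintype.sum_prod_type']
    exact Fintype.sum_equiv Perm.decomposeFin _ _ fun σ => by simp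
  have h1 : (1 : Fin 4) = Fin.succ 0 := rfl
  have h2 : (2 : Fin 4) = Fin.succ (Fin.succ 0) := rfl
  have h3 : (3 : Fin 4) = Fin.succ (Fin.succ (Fin.succ 0)) := rfl
  simp only [key, Fin.sum_univ_succ, Finset.univ_eq_empty, Finset.sum_empty, h1, h2, h3,
    Perm.decomposeFin_symm_apply_zero, Perm.decomposeFin_symm_apply_succ,
    Perm.decomposeFin.symm_sign]
  simp [Fin.ext_iff, swap_apply_def]
  abel

/-- Here `a`, `b` play the vertical vectors. The eight terms which pair `a` with `b` vanish, so `c x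
y` is irrelevant; the other sixteen form four groups of four, which cancels the factor `1/(2!2!)`.
The order of the products is kept because `R` need not be commutative. -/
theorem wedge_two_two (c : T → T → R) {a b : T} {A B : T → R} {x y : T} (hab : c a b = 0)
    (hba : c b a = 0) (hax : c a x = A x) (hxa : c x a = -A x) (hay : c a y = A y)
    (hya : c y a = -A y) (hbx : c b x = B x) (hxb : c x b = -B x) (hby : c b y = B y)
    (hyb : c y b = -B y) :
    wedge (p := 2) (q := 2) (fun w => c (w 0) (w 1)) (fun w => c (w 0) (w 1)) ![a, b, x, y] =
      A y * B x + B x * A y - A x * B y - B y * A x := by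
  have h := sum_perm_fin_four fun i j k l : Fin 4 =>
    c (![a, b, x, y] i) (![a, b, x, y] j) * c (![a, b, x, y] k) (![a, b, x, y] l)
  change ((Nat.factorial 2 * Nat.factorial 2 : ℂ))⁻¹ • (∑ σ : Perm (Fin 4),
    (Perm.sign σ : ℤ) • (c (![a, b, x, y] (σ 0)) (![a, b, x, y] (σ 1)) *
      c (![a, b, x, y] (σ 2)) (![a, b, x, y] (σ 3)))) = _
  rw [h]
  simp [hab, hba, hax, hxa, hay, hya, hbx, hxb, hby, hyb]
  match_scalars <;> norm_num

end WedgeAlgebra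

/-! ### Sign of the expansion of `β ∧ κ^m` on a frame adapted to `κ`. -/

section PairExpansion

open Equiv

/-- The `e`-th member of the `l`-th pair of adjacent indices. -/
def pairIdx {k : ℕ} (l : Fin k) (e : Fin 2) : Fin (2 * k) := ⟨2 * l + e, by omega⟩

variable {T : Type*}

/-- The product of the values of `α` on the pairs of adjacent arguments. -/
def pairProd (α : (Fin 2 → T) → ℂ) (k : ℕ) (v : Fin (2 * k) → T) : ℂ :=
  ∏ l : Fin k, α (fun e => v (pairIdx l e))

theorem pairProd_succ (α : (Fin 2 → T) → ℂ) (k : ℕ) :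
    pairProd α (k + 1) = tensorMul (p := 2 * k) (q := 2) (pairProd α k) α := by
  funext v
  unfold pairProd tensorMul
  rw [Fin.prod_univ_castSucc]
  rfl

/-- Every further factor `α` contributes `1/2!`, while `(2k)!` cancels against the inner
antisymmetrisation. Only the positivity of the constant and its independence of `α` and `v` matter
later. -/
theorem wedgePow_eq_altSum (k : ℕ) : ∃ C : ℝ, 0 < C ∧ ∀ (α : (Fin 2 → T) → ℂ)
    (v : Fin (2 * k) → T), wedgePow α k v = (C : ℂ) • altSum (pairProd α k) v := by
  induction k with
  | zero =>
    refine ⟨1, one_pos, fun α v => ?_⟩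
    have : Subsingleton (Perm (Fin (2 * 0))) := inferInstanceAs (Subsingleton (Perm (Fin 0)))
    rw [altSum, Fintype.sum_subsingleton _ (1 : Perm (Fin (2 * 0)))]
    simp [wedgePow, pairProd]
  | succ k ih =>
    obtain ⟨C, hC, h⟩ := ih
    refine ⟨C * 2⁻¹, by positivity, fun α v => ?_⟩
    have h1 : wedgePow α k = fun w => (C : ℂ) • altSum (pairProd α k) w := funext (h α)
    change wedge (wedgePow α k) α v = _
    have h2 : ((2 * k).factorial : ℂ) ≠ 0 := Nat.cast_ne_zero.2 (Nat.factorial_ne_zero _)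
    rw [h1, wedge_const_smul_left, wedge_eq_altSum, altSum_tensorMul_altSum_left, pairProd_succ,
      ← Nat.cast_smul_eq_nsmul ℂ, smul_smul, smul_smul]
    congr 1
    simp only [Nat.factorial_two]
    push_cast
    field_simp

theorem wedge_wedgePow_eq (m : ℕ) : ∃ C : ℝ, 0 < C ∧ ∀ (β κ : (Fin 2 → T) → ℝ)
    (v : Fin (2 + 2 * m) → T),
    wedge (fun w => (β w : ℂ)) (wedgePow (fun w => (κ w : ℂ)) m) v =
      ((C * ∑ σ : Perm (Fin (2 + 2 * m)), ((Perm.sign σ : ℤ) : ℝ) *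
        (β (fun e => v (σ (Fin.castAdd (2 * m) e))) *
          ∏ l : Fin m, κ (fun e => v (σ (Fin.natAdd 2 (pairIdx l e))))) : ℝ) : ℂ) := by
  obtain ⟨C, hC, h⟩ := wedgePow_eq_altSum (T := T) m
  refine ⟨C * 2⁻¹, by positivity, fun β κ v => ?_⟩
  have h1 : wedgePow (fun w => (κ w : ℂ)) m =
      fun w => altSum (fun w => (C : ℂ) • pairProd (fun w => (κ w : ℂ)) m w) w :=
    funext fun w => by rw [h, altSum_smul]
  have h2 : ((2 * m).factorial : ℂ) ≠ 0 := Nat.cast_ne_zero.2 (Nat.factorial_ne_zero _)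
  rw [h1, wedge_eq_altSum, altSum_tensorMul_altSum_right, ← Nat.cast_smul_eq_nsmul ℂ, smul_smul]
  have h3 : (((Nat.factorial 2 : ℂ) * ((2 * m).factorial : ℂ))⁻¹ * ((2 * m).factorial : ℂ)) =
      2⁻¹ := by
    simp only [Nat.factorial_two]
    push_cast
    field_simp
  rw [h3]
  simp only [altSum, tensorMul, pairProd, smul_eq_mul]
  push_cast
  rw [Finset.mul_sum, Finset.mul_sum]
  refine Finset.sum_congr rfl fun σ _ => ?_
  rw [zsmul_eq_mul]
  ring

/-- Three different points of `Fin N × Fin 2` are not in the same fibre. -/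
theorem fibre_two_elements {N : ℕ} {i j k : Fin N × Fin 2} (hij : i.1 = j.1) (hik : i.1 = k.1)
    (h1 : i ≠ j) (h2 : i ≠ k) : j = k := by
  obtain ⟨i1, i2⟩ := i
  obtain ⟨j1, j2⟩ := j
  obtain ⟨k1, k2⟩ := k
  simp only [ne_eq, Prod.mk.injEq] at *
  subst hij hik
  simp only [true_and] at *
  omega

/-- A permutation which respects pairs is a permutation of the pairs composed with
transpositions inside pairs. -/
theorem sign_of_pairs {N : ℕ} (σ : Perm (Fin N × Fin 2))
    (h : ∀ l, (σ (l, 0)).1 = (σ (l, 1)).1) :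
    Perm.sign σ = ∏ l, (if (σ (l, 0)).2 = 0 then 1 else -1) := by
  have hinj : Function.Injective fun l => (σ (l, 0)).1 := by
    intro l l' hl
    by_contra hne
    have h1 := fibre_two_elements (hl : (σ (l, 0)).1 = (σ (l', 0)).1) (h l)
      (by simpa using hne) (by simp)
    simp [Ne.symm hne] at h1
  set ρ : Perm (Fin N) := Equiv.ofBijective _ (Finite.injective_iff_bijective.1 hinj)
  set s : Fin N → Perm (Fin 2) := fun l => if (σ (l, 0)).2 = 0 then 1 else swap 0 1
  have hσ : σ = (Equiv.prodCongrLeft fun _ : Fin 2 => ρ) * Equiv.prodCongrRight s := by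
    ext1 ⟨l, e⟩
    have h0 : (σ (l, 0)).2 ≠ (σ (l, 1)).2 := fun h' => by
      have := σ.injective (Prod.ext (h l) h')
      simp at this
    refine Prod.ext ?_ ?_
    · change (σ (l, e)).1 = (σ (l, 0)).1
      fin_cases e
      · rfl
      · exact (h l).symm
    · change (σ (l, e)).2 = s l e
      simp only [s]
      fin_cases e
      · split_ifs with h'
        · exact h'
        · simp; omega
      · split_ifs with h'
        · simp; omega
        · simp; omega
  -- The permutation `ρ` of the pairs acts on both members of each pair, so its sign enters squared;
  -- only the transpositions inside pairs count.
  rw [hσ, Perm.sign_mul, Perm.sign_prodCongrLeft, Perm.sign_prodCongrRight, ← hσ]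
  simp only [Finset.prod_const, Finset.card_univ, Fintype.card_fin, Int.units_sq, one_mul]
  refine Finset.prod_congr rfl fun l _ => ?_
  simp only [s]
  split_ifs
  · exact Perm.sign_one
  · exact Perm.sign_swap (by decide)

/-- Since `W` vanishes between different pairs, a nonzero term comes from a permutation that
respects pairs. Its sign is the product of the signs of the flips inside pairs, and these are
exactly the signs produced by antisymmetry of `B` and `W`. -/
theorem pairs_term_nonneg {m : ℕ} {B W : Fin (m + 1) × Fin 2 → Fin (m + 1) × Fin 2 → ℝ}
    (hB : ∀ i j, B j i = -B i j) (hW : ∀ i j, W j i = -W i j)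
    (hW0 : ∀ i j, i.1 ≠ j.1 → W i j = 0) (hW1 : ∀ l, 0 < W (l, 0) (l, 1))
    (hB1 : ∀ l, 0 ≤ B (l, 0) (l, 1)) (σ : Perm (Fin (m + 1) × Fin 2)) :
    0 ≤ ((Perm.sign σ : ℤ) : ℝ) *
      (B (σ (0, 0)) (σ (0, 1)) * ∏ l : Fin m, W (σ (l.succ, 0)) (σ (l.succ, 1))) := by
  by_cases h : ∀ l : Fin m, (σ (l.succ, 0)).1 = (σ (l.succ, 1)).1
  swap
  · push Not at h
    obtain ⟨l, hl⟩ := h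
    rw [Finset.prod_eq_zero (Finset.mem_univ l) (hW0 _ _ hl), mul_zero, mul_zero]
  -- The pair left over for `B` must also go to a pair: if the partner of `σ (0, 0)` came from a
  -- pair `l.succ`, that whole pair would map into the fibre of `σ (0, 0)`, giving it three points.
  have h0 : (σ (0, 0)).1 = (σ (0, 1)).1 := by
    obtain ⟨⟨l, e⟩, hle⟩ := σ.surjective ((σ (0, 0)).1, (σ (0, 0)).2 + 1)
    have h1 : (σ (l, e)).1 = (σ (0, 0)).1 := by rw [hle]
    have h2 : (l, e) ≠ (0, 0) := by
      rintro h'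
      rw [h'] at hle
      have := congrArg Prod.snd hle
      simp at this
    refine Fin.cases (motive := fun l => (σ (l, e)).1 = (σ (0, 0)).1 → (l, e) ≠ (0, 0) → _)
      (fun h1 h2 => ?_) (fun l h1 _ => ?_) l h1 h2
    · have : e = 1 := by
        by_contra h'
        exact h2 (Prod.ext rfl (by simp; omega))
      rw [← h1, this]
    · exfalso
      have h3 : (σ (l.succ, 0)).1 = (σ (0, 0)).1 := by
        fin_cases e
        · exact h1
        · exact (h l).trans h1
      have h4 := fibre_two_elements (h3.symm.trans (h l)) h3.symm
        (by simp [(Fin.succ_ne_zero l).symm]) (by simp [(Fin.succ_ne_zero l).symm])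
      simp at h4
  have hall : ∀ l, (σ (l, 0)).1 = (σ (l, 1)).1 := Fin.cases h0 h
  have key : ∀ M : Fin (m + 1) × Fin 2 → Fin (m + 1) × Fin 2 → ℝ, (∀ i j, M j i = -M i j) →
      ∀ l, (((if (σ (l, 0)).2 = 0 then 1 else -1 : ℤˣ) : ℤ) : ℝ) * M (σ (l, 0)) (σ (l, 1)) =
        M ((σ (l, 0)).1, 0) ((σ (l, 0)).1, 1) := by
    intro M hM l
    have h5 : (σ (l, 0)).2 ≠ (σ (l, 1)).2 := fun h' => by
      have := σ.injective (Prod.ext (hall l) h')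
      simp at this
    split_ifs with h'
    · rw [show σ (l, 0) = ((σ (l, 0)).1, 0) from Prod.ext rfl h',
        show σ (l, 1) = ((σ (l, 0)).1, 1) from Prod.ext (hall l).symm (by simp; omega)]
      simp
    · rw [show σ (l, 0) = ((σ (l, 0)).1, 1) from Prod.ext rfl (by simp; omega),
        show σ (l, 1) = ((σ (l, 0)).1, 0) from Prod.ext (hall l).symm (by simp; omega), hM]
      simp
  have hs : ((Perm.sign σ : ℤ) : ℝ) = ∏ l, (((if (σ (l, 0)).2 = 0 then 1 else -1 : ℤˣ) : ℤ) : ℝ) := by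
    rw [sign_of_pairs σ hall]
    push_cast
    rfl
  rw [hs, Fin.prod_univ_succ, mul_mul_mul_comm, ← Finset.prod_mul_distrib, key B hB]
  simp_rw [key W hW]
  exact mul_nonneg (hB1 _) (Finset.prod_nonneg fun l _ => (hW1 _).le)

/-- The pairing of `{0, …, 2m+1}` into adjacent pairs. -/
def pairEquiv (m : ℕ) : Fin (m + 1) × Fin 2 ≃ Fin (2 + 2 * m) where
  toFun i := ⟨2 * i.1 + i.2, by omega⟩
  invFun j := (⟨j / 2, by omega⟩, ⟨j % 2, by omega⟩)
  left_inv i := by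
    refine Prod.ext (Fin.ext ?_) (Fin.ext ?_) <;> simp <;> omega
  right_inv j := by
    refine Fin.ext ?_
    simp; omega

variable {β κ : (Fin 2 → T) → ℝ} {m : ℕ} {u : Fin (m + 1) × Fin 2 → T}

theorem wedge_wedgePow_pairs : ∃ C : ℝ, 0 < C ∧ ∀ (β κ : (Fin 2 → T) → ℝ)
    (u : Fin (m + 1) × Fin 2 → T),
    wedge (fun w => (β w : ℂ)) (wedgePow (fun w => (κ w : ℂ)) m) (fun i => u ((pairEquiv m).symm i))
    = ((C * ∑ σ : Perm (Fin (m + 1) × Fin 2), ((Perm.sign σ : ℤ) : ℝ) *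
        (β ![u (σ (0, 0)), u (σ (0, 1))] *
          ∏ l : Fin m, κ ![u (σ (l.succ, 0)), u (σ (l.succ, 1))]) : ℝ) : ℂ) := by
  obtain ⟨C, hC, h⟩ := wedge_wedgePow_eq (T := T) m
  refine ⟨C, hC, fun β κ u => ?_⟩
  rw [h]
  congr 2
  refine Fintype.sum_equiv (pairEquiv m).symm.permCongr _ _ fun σ => ?_
  rw [Perm.sign_permCongr]
  simp only [Equiv.permCongr_apply, Equiv.symm_symm]
  have h0 : ∀ e : Fin 2, Fin.castAdd (2 * m) e = pairEquiv m (0, e) := fun e =>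
    Fin.ext (by simp [pairEquiv])
  have h1 : ∀ (l : Fin m) (e : Fin 2), Fin.natAdd 2 (pairIdx l e) = pairEquiv m (l.succ, e) :=
    fun l e => Fin.ext (by simp [pairEquiv, pairIdx]; omega)
  have h2 : ∀ f : Fin 2 → T, f = ![f 0, f 1] := fun f => by
    funext i; fin_cases i <;> rfl
  simp only [h0, h1]
  rw [h2 fun e => _]
  congr 3
  funext l
  rw [h2 fun e => _]

theorem wedge_wedgePow_nonneg (hβ : ∀ x y, β ![y, x] = -β ![x, y])
    (hκ : ∀ x y, κ ![y, x] = -κ ![x, y])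
    (hκ0 : ∀ i j, i.1 ≠ j.1 → κ ![u i, u j] = 0) (hκ1 : ∀ l, 0 < κ ![u (l, 0), u (l, 1)])
    (hβ1 : ∀ l, 0 ≤ β ![u (l, 0), u (l, 1)]) :
    0 ≤ (wedge (fun w => (β w : ℂ)) (wedgePow (fun w => (κ w : ℂ)) m)
      (fun i => u ((pairEquiv m).symm i))).re := by
  obtain ⟨C, hC, h⟩ := wedge_wedgePow_pairs (T := T) (m := m)
  rw [h, Complex.ofReal_re]
  exact mul_nonneg hC.le (Finset.sum_nonneg fun σ _ => pairs_term_nonneg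
    (B := fun i j => β ![u i, u j]) (W := fun i j => κ ![u i, u j])
    (fun _ _ => hβ _ _) (fun _ _ => hκ _ _) hκ0 hκ1 hβ1 σ)

/-- All terms are nonnegative, so one positive term suffices: exchange pair `0` with pair `l₀` as a
whole, which is an even permutation and puts `β` on pair `l₀`. -/
theorem wedge_wedgePow_pos (hβ : ∀ x y, β ![y, x] = -β ![x, y])
    (hκ : ∀ x y, κ ![y, x] = -κ ![x, y])
    (hκ0 : ∀ i j, i.1 ≠ j.1 → κ ![u i, u j] = 0) (hκ1 : ∀ l, 0 < κ ![u (l, 0), u (l, 1)])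
    (hβ1 : ∀ l, 0 ≤ β ![u (l, 0), u (l, 1)]) (l₀ : Fin (m + 1))
    (hl₀ : 0 < β ![u (l₀, 0), u (l₀, 1)]) :
    0 < (wedge (fun w => (β w : ℂ)) (wedgePow (fun w => (κ w : ℂ)) m)
      (fun i => u ((pairEquiv m).symm i))).re := by
  obtain ⟨C, hC, h⟩ := wedge_wedgePow_pairs (T := T) (m := m)
  rw [h, Complex.ofReal_re]
  refine mul_pos hC (Finset.sum_pos' (fun σ _ => pairs_term_nonneg
    (B := fun i j => β ![u i, u j]) (W := fun i j => κ ![u i, u j])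
    (fun _ _ => hβ _ _) (fun _ _ => hκ _ _) hκ0 hκ1 hβ1 σ)
    ⟨Equiv.prodCongrLeft fun _ : Fin 2 => swap 0 l₀, Finset.mem_univ _, ?_⟩)
  rw [Perm.sign_prodCongrLeft]
  simp only [Finset.prod_const, Finset.card_univ, Fintype.card_fin, Int.units_sq, Units.val_one,
    Int.cast_one, one_mul, Equiv.prodCongrLeft_apply, swap_apply_left]
  exact mul_pos hl₀ (Finset.prod_pos fun l _ => hκ1 _)

end PairExpansion

/-! ### Wedge products as alternating maps; top forms under complex-linear maps. -/

section AlternatingMaps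

variable {V : Type*} [AddCommGroup V] [Module ℝ V]

/-- The wedge product of alternating maps is an alternating map. -/
theorem exists_alternatingMap_wedge {p q : ℕ} (α : V [⋀^Fin p]→ₗ[ℝ] ℂ) (β : V [⋀^Fin q]→ₗ[ℝ] ℂ) :
    ∃ γ : V [⋀^Fin (p + q)]→ₗ[ℝ] ℂ, ∀ v, γ v = wedge α β v := by
  refine ⟨((p.factorial * q.factorial : ℂ))⁻¹ • MultilinearMap.alternatization
    (((LinearMap.mul' ℝ ℂ).compMultilinearMap
      (MultilinearMap.domCoprod α.toMultilinearMap β.toMultilinearMap)).domDomCongr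
      finSumFinEquiv), fun v => ?_⟩
  rw [AlternatingMap.smul_apply, MultilinearMap.alternatization_apply, wedge_eq_altSum]
  rfl

theorem exists_alternatingMap_wedgePow (α : V [⋀^Fin 2]→ₗ[ℝ] ℂ) (k : ℕ) :
    ∃ γ : V [⋀^Fin (2 * k)]→ₗ[ℝ] ℂ, ∀ v, γ v = wedgePow α k v := by
  induction k with
  | zero => exact ⟨AlternatingMap.constOfIsEmpty ℝ V (Fin 0) (1 : ℂ), fun v => rfl⟩
  | succ k ih =>
    obtain ⟨γ, hγ⟩ := ih
    obtain ⟨δ, hδ⟩ := exists_alternatingMap_wedge γ α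
    refine ⟨δ, fun v => (hδ v).trans ?_⟩
    rw [show (⇑γ : (Fin (2 * k) → V) → ℂ) = wedgePow α k from funext hγ]
    rfl

/-- The alternating 2-form associated with an alternating bilinear map. -/
def LinearMap.toAlternatingTwo {M : Type*} [AddCommGroup M] [Module ℝ M] (B : V →ₗ[ℝ] V →ₗ[ℝ] M)
    (hB : ∀ v, B v v = 0) : V [⋀^Fin 2]→ₗ[ℝ] M where
  toFun v := B (v 0) (v 1)
  map_update_add' {inst} v i x y := by
    obtain rfl : inst = instDecidableEqFin 2 := Subsingleton.elim _ _
    fin_cases i <;> simp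
  map_update_smul' {inst} v i c x := by
    obtain rfl : inst = instDecidableEqFin 2 := Subsingleton.elim _ _
    fin_cases i <;> simp
  map_eq_zero_of_eq' v i j h hij := by
    fin_cases i <;> fin_cases j <;> simp_all

theorem LinearMap.toAlternatingTwo_apply {M : Type*} [AddCommGroup M] [Module ℝ M]
    (B : V →ₗ[ℝ] V →ₗ[ℝ] M) (hB : ∀ v, B v v = 0) (v : Fin 2 → V) :
    B.toAlternatingTwo hB v = B (v 0) (v 1) := rfl

end AlternatingMaps

/-- A complex linear map multiplies a real form of top degree by `|det|²`. -/
theorem AlternatingMap.map_complexLinear {V : Type*} [AddCommGroup V] [Module ℂ V]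
    [FiniteDimensional ℂ V] {n : ℕ} (hn : Module.finrank ℂ V = n)
    (γ : V [⋀^Fin (2 * n)]→ₗ[ℝ] ℝ) (L : V →ₗ[ℂ] V) (v : Fin (2 * n) → V) :
    γ (fun i => L (v i)) = Complex.normSq (LinearMap.det L) * γ v := by
  have hr : Module.finrank ℝ V = 2 * n := by rw [finrank_real_of_complex, hn]
  have : FiniteDimensional ℝ V := FiniteDimensional.complexToReal V
  set e := Module.finBasisOfFinrankEq ℝ V hr
  have h1 := e.det_comp (L.restrictScalars ℝ) v
  -- The real determinant of a complex-linear map is the norm from `ℂ` to `ℝ` of its complex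
  -- determinant.
  rw [LinearMap.det_restrictScalars, Algebra.norm_complex_eq] at h1
  rw [γ.eq_smul_basis_det e]
  simp only [AlternatingMap.smul_apply, smul_eq_mul]
  have h2 : e.det (fun i => L (v i)) = Complex.normSq (LinearMap.det L) * e.det v := h1
  rw [h2]
  ring

/-! ### Traces of products of skew-Hermitian endomorphisms. -/

section HermitianForms

variable {V : Type*} [AddCommGroup V] [Module ℂ V] [FiniteDimensional ℂ V]

/-- A positive definite Hermitian form has an orthonormal basis. -/
theorem exists_orthonormal_basis {n : ℕ} (hn : Module.finrank ℂ V = n) (B : V → V → ℂ)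
    (hconj : ∀ e f, starRingEnd ℂ (B e f) = B f e) (hadd : ∀ e f g, B e (f + g) = B e f + B e g)
    (hsmul : ∀ (c : ℂ) e f, B e (c • f) = c * B e f) (hpos : ∀ e, e ≠ 0 → 0 < (B e e).re) :
    ∃ b : Module.Basis (Fin n) ℂ V, ∀ i v, B (b i) v = b.repr v i := by
  have hz : ∀ e, B e 0 = 0 := fun e => by simpa using hsmul 0 e 0
  let C : InnerProductSpace.Core ℂ V :=
    { inner := B
      conj_inner_symm := fun x y => hconj y x
      re_inner_nonneg := fun x => by
        by_cases hx : x = 0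
        · subst hx
          exact (congrArg Complex.re (hz 0)).ge
        · exact (hpos x hx).le
      add_left := fun x y z => by
        change B (x + y) z = B x z + B y z
        rw [← hconj z (x + y), hadd, map_add, hconj, hconj]
      smul_left := fun x y r => by
        change B (r • x) y = starRingEnd ℂ r * B x y
        rw [← hconj y (r • x), hsmul, map_mul, hconj]
      definite := fun x hx => by
        by_contra h
        have h1 := hpos x h
        have h2 : B x x = 0 := hx
        simp [h2] at h1 }
  let _ : NormedAddCommGroup V := C.toNormedAddCommGroup
  let _ : InnerProductSpace ℂ V := InnerProductSpace.ofCore C.toCore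
  let b := (stdOrthonormalBasis ℂ V).reindex (finCongr hn)
  refine ⟨b.toBasis, fun i v => ?_⟩
  rw [b.coe_toBasis, b.coe_toBasis_repr_apply, b.repr_apply_apply]
  rfl

variable {B : V → V → ℂ} (hconj : ∀ e f, starRingEnd ℂ (B e f) = B f e)
  (hadd : ∀ e f g, B e (f + g) = B e f + B e g)
  (hsmul : ∀ (c : ℂ) e f, B e (c • f) = c * B e f) (hpos : ∀ e, e ≠ 0 → 0 < (B e e).re)

include hconj hadd hsmul hpos

theorem exists_trace_eq_sum : ∃ b : Module.Basis (Fin (Module.finrank ℂ V)) ℂ V,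
    ∀ S : Module.End ℂ V, LinearMap.trace ℂ V S = ∑ i, B (b i) (S (b i)) := by
  obtain ⟨b, hb⟩ := exists_orthonormal_basis rfl B hconj hadd hsmul hpos
  refine ⟨b, fun S => ?_⟩
  rw [LinearMap.trace_eq_matrix_trace ℂ b S]
  refine Finset.sum_congr rfl fun i _ => ?_
  rw [Matrix.diag_apply, LinearMap.toMatrix_apply, hb]

/-- The trace of the product of two skew-Hermitian endomorphisms is real. -/
theorem trace_mul_skew_im {S T : Module.End ℂ V} (hS : ∀ e f, B (S e) f + B e (S f) = 0)
    (hT : ∀ e f, B (T e) f + B e (T f) = 0) : (LinearMap.trace ℂ V (S * T)).im = 0 := by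
  obtain ⟨b, hb⟩ := exists_trace_eq_sum hconj hadd hsmul hpos
  rw [← Complex.conj_eq_iff_im]
  -- The adjoint of `S * T` is `T * S`, the two minus signs cancelling, so the conjugate trace is
  -- compared with the trace of `T * S`.
  conv_rhs => rw [LinearMap.trace_mul_comm]
  rw [hb, hb, map_sum]
  refine Finset.sum_congr rfl fun i _ => ?_
  rw [hconj]
  simp only [Module.End.mul_apply]
  linear_combination hS (T (b i)) (b i) - hT (b i) (S (b i))

/-- In an orthonormal basis the trace of `S²` is `-∑ |S bᵢ|²`. The strict version below uses that `S
≠ 0` moves some basis vector to a nonzero one. -/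
theorem trace_sq_skew_nonpos {S : Module.End ℂ V} (hS : ∀ e f, B (S e) f + B e (S f) = 0) :
    (LinearMap.trace ℂ V (S * S)).re ≤ 0 := by
  obtain ⟨b, hb⟩ := exists_trace_eq_sum hconj hadd hsmul hpos
  rw [hb, Complex.re_sum]
  refine Finset.sum_nonpos fun i _ => ?_
  have h1 : B (b i) ((S * S) (b i)) = -B (S (b i)) (S (b i)) := by
    simp only [Module.End.mul_apply]
    linear_combination hS (b i) (S (b i))
  rw [h1, Complex.neg_re, neg_nonpos]
  by_cases h : S (b i) = 0
  · have : B 0 0 = 0 := by simpa using hsmul 0 0 0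
    simp [h, this]
  · exact (hpos _ h).le

theorem trace_sq_skew_neg {S : Module.End ℂ V} (hS : ∀ e f, B (S e) f + B e (S f) = 0)
    (h0 : S ≠ 0) : (LinearMap.trace ℂ V (S * S)).re < 0 := by
  obtain ⟨b, hb⟩ := exists_trace_eq_sum hconj hadd hsmul hpos
  rw [hb, Complex.re_sum]
  have h1 : ∀ i, B (b i) ((S * S) (b i)) = -B (S (b i)) (S (b i)) := fun i => by
    simp only [Module.End.mul_apply]
    linear_combination hS (b i) (S (b i))
  have hz : B 0 0 = 0 := by simpa using hsmul 0 0 0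
  obtain ⟨i, hi⟩ : ∃ i, S (b i) ≠ 0 := by
    by_contra! h
    exact h0 (b.ext fun i => by simpa using h i)
  refine Finset.sum_neg' (fun i _ => ?_) ⟨i, Finset.mem_univ _, ?_⟩
  · rw [h1, Complex.neg_re, neg_nonpos]
    by_cases h : S (b i) = 0
    · simp [h, hz]
    · exact (hpos _ h).le
  · rw [h1, Complex.neg_re, neg_lt_zero]
    exact hpos _ hi

end HermitianForms

/-! ### Positivity of `β ∧ κ^{n-1}` on complex frames. -/

section PointwisePositivity

variable {n : ℕ}

theorem AlternatingMap.two_swap {V M : Type*} [AddCommGroup V] [Module ℝ V] [AddCommGroup M]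
    [Module ℝ M] (α : V [⋀^Fin 2]→ₗ[ℝ] M) (x y : V) : α ![y, x] = -α ![x, y] := by
  have h := α.map_swap ![x, y] (i := 0) (j := 1) (by decide)
  rw [← h]
  congr 1
  funext i
  fin_cases i <;> rfl

theorem update_pair_one {V : Type*} (x y z : V) : Function.update ![x, y] 1 z = ![x, z] := by
  funext i
  fin_cases i <;> simp

theorem AlternatingMap.two_add_right {V M : Type*} [AddCommGroup V] [Module ℝ V] [AddCommGroup M]
    [Module ℝ M] (α : V [⋀^Fin 2]→ₗ[ℝ] M) (x y z : V) :
    α ![x, y + z] = α ![x, y] + α ![x, z] := by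
  simpa only [update_pair_one] using α.map_update_add ![x, 0] 1 y z

theorem AlternatingMap.two_smul_right {V M : Type*} [AddCommGroup V] [Module ℝ V]
    [AddCommGroup M] [Module ℝ M] (α : V [⋀^Fin 2]→ₗ[ℝ] M) (c : ℝ) (x y : V) :
    α ![x, c • y] = c • α ![x, y] := by
  simpa only [update_pair_one] using α.map_update_smul ![x, 0] 1 c y

theorem AlternatingMap.two_neg_right {V M : Type*} [AddCommGroup V] [Module ℝ V]
    [AddCommGroup M] [Module ℝ M] (α : V [⋀^Fin 2]→ₗ[ℝ] M) (x y : V) :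
    α ![x, -y] = -α ![x, y] := by
  simpa using α.two_smul_right (-1) x y

/-- A positive form of type `(1,1)` has a complex basis which diagonalises it. -/
theorem exists_unitary_frame (κ : Cn n [⋀^Fin 2]→ₗ[ℝ] ℝ)
    (hinv : ∀ v w, κ ![Complex.I • v, Complex.I • w] = κ ![v, w])
    (hpos : ∀ v, v ≠ 0 → 0 < κ ![v, Complex.I • v]) :
    ∃ b : Module.Basis (Fin n) ℂ (Cn n), (∀ i j, i ≠ j → κ ![b i, b j] = 0) ∧
      ∀ i j, i ≠ j → κ ![b i, Complex.I • b j] = 0 := by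
  have hI : ∀ v : Cn n, Complex.I • Complex.I • v = -v := fun v => by
    rw [smul_smul, Complex.I_mul_I, neg_one_smul]
  have hIv : ∀ v w, κ ![w, Complex.I • v] = κ ![v, Complex.I • w] := fun v w => by
    rw [← hinv w, hI, κ.two_neg_right, ← κ.two_swap]
  -- The Hermitian form attached to `κ` is `κ(v, Iw) + i κ(v, w)`; its real and imaginary parts give
  -- the two orthogonality relations.
  obtain ⟨b, hb⟩ := exists_orthonormal_basis (V := Cn n) (n := n) (by simp)
    (fun v w => (κ ![v, Complex.I • w] : ℂ) + Complex.I * κ ![v, w])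
    (fun v w => by
      simp only [map_add, map_mul, Complex.conj_ofReal, Complex.conj_I]
      rw [hIv, κ.two_swap v w]
      push_cast
      ring)
    (fun u v w => by
      simp only [smul_add, κ.two_add_right]
      push_cast
      ring)
    (fun c v w => by
      have h1 : ∀ c : ℂ, ∀ w : Cn n, c • w = c.re • w + c.im • Complex.I • w := fun c w => by
        funext i
        simp only [Pi.smul_apply, Pi.add_apply, smul_eq_mul, Complex.real_smul]
        conv_lhs => rw [← Complex.re_add_im c]
        ring
      have h2 : Complex.I • c • w = c.re • Complex.I • w + c.im • (-w) := by
        rw [smul_comm, h1, hI]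
      rw [h2, h1 c w]
      simp only [κ.two_add_right, κ.two_smul_right, κ.two_neg_right, smul_eq_mul]
      push_cast
      conv_rhs => rw [← Complex.re_add_im c]
      linear_combination (-(c.im : ℂ) * κ ![v, w]) * Complex.I_mul_I)
    (fun v hv => by simpa using hpos v hv)
  have h0 : ∀ i j, i ≠ j →
      (κ ![b i, Complex.I • b j] : ℂ) + Complex.I * κ ![b i, b j] = 0 := fun i j hij => by
    rw [hb, b.repr_self, Finsupp.single_apply, if_neg (Ne.symm hij)]
  refine ⟨b, fun i j hij => ?_, fun i j hij => ?_⟩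
  · simpa using congrArg Complex.im (h0 i j hij)
  · simpa using congrArg Complex.re (h0 i j hij)

theorem degree_eq (n : ℕ) [NeZero n] : 2 + 2 * (n - 1) = 2 * n := by
  have := NeZero.pos n; omega

/-- The real form `β ∧ κ^{n-1}` of top degree, as an alternating map. -/
theorem exists_topForm [NeZero n] (β κ : Cn n [⋀^Fin 2]→ₗ[ℝ] ℝ) :
    ∃ γ : Cn n [⋀^Fin (2 * n)]→ₗ[ℝ] ℝ, ∀ v, γ v =
      (wedge (fun w => (β w : ℂ)) (wedgePow (fun w => (κ w : ℂ)) (n - 1))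
        (fun i => v (Fin.cast (degree_eq n) i))).re := by
  obtain ⟨δ, hδ⟩ := exists_alternatingMap_wedgePow
    (Complex.ofRealCLM.toLinearMap.compAlternatingMap κ) (n - 1)
  obtain ⟨γ, hγ⟩ := exists_alternatingMap_wedge
    (Complex.ofRealCLM.toLinearMap.compAlternatingMap β) δ
  refine ⟨Complex.reCLM.toLinearMap.compAlternatingMap
    (γ.domDomCongr (finCongr (degree_eq n))), fun v => ?_⟩
  have h1 : (⇑δ : (Fin (2 * (n - 1)) → Cn n) → ℂ) =
    wedgePow (fun w => (κ w : ℂ)) (n - 1) := funext hδ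
  rw [h1] at hγ
  exact congrArg Complex.re (hγ _)

theorem stdFrame_pair (l : Fin n) :
    stdFrame n ⟨2 * l, by omega⟩ = Pi.single l 1 ∧
      stdFrame n ⟨2 * l + 1, by omega⟩ = Complex.I • Pi.single l 1 := by
  have h1 : (2 * (l : ℕ)) / 2 = l := by omega
  have h2 : (2 * (l : ℕ) + 1) / 2 = l := by omega
  have h3 : (2 * (l : ℕ) + 1) % 2 ≠ 0 := by omega
  constructor
  · simp [stdFrame]
  · rw [← Pi.single_smul]
    simp only [stdFrame, h2, if_neg h3]
    simp

/-- The standard frame, moved by a complex linear map, in terms of pairs. -/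
theorem stdFrame_map {m : ℕ} (M : Cn (m + 1) →ₗ[ℂ] Cn (m + 1)) (i : Fin (2 + 2 * m)) :
    M (stdFrame (m + 1) (Fin.cast (degree_eq (m + 1)) i)) =
      (fun p : Fin (m + 1) × Fin 2 => ![M (Pi.single p.1 1), Complex.I • M (Pi.single p.1 1)] p.2)
        ((pairEquiv m).symm i) := by
  obtain ⟨⟨l, e⟩, rfl⟩ := (pairEquiv m).surjective i
  rw [Equiv.symm_apply_apply]
  fin_cases e
  · exact congrArg M (stdFrame_pair l).1
  · exact (congrArg M (stdFrame_pair l).2).trans (map_smul _ _ _)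

variable [NeZero n] {β κ : Cn n [⋀^Fin 2]→ₗ[ℝ] ℝ}
  (hinv : ∀ v w, κ ![Complex.I • v, Complex.I • w] = κ ![v, w])
  (hpos : ∀ v, v ≠ 0 → 0 < κ ![v, Complex.I • v])
  (hβ : ∀ v, 0 ≤ β ![v, Complex.I • v]) (D : Cn n →ₗ[ℂ] Cn n)

include hinv hpos hβ

/-- `M` carries the standard basis to one diagonalising `κ`, where the expansion over pairs applies.
The strict part asks for a positive value of `β` in every basis because the diagonalising one is not
known to the caller. -/
theorem exists_topForm_frame : ∃ M : Cn n →ₗ[ℂ] Cn n, LinearMap.det M ≠ 0 ∧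
    0 ≤ (wedge (fun w => (β w : ℂ)) (wedgePow (fun w => (κ w : ℂ)) (n - 1))
      (fun i => M (stdFrame n (Fin.cast (degree_eq n) i)))).re ∧
    ((∀ b : Module.Basis (Fin n) ℂ (Cn n), ∃ l, 0 < β ![b l, Complex.I • b l]) →
    0 < (wedge (fun w => (β w : ℂ)) (wedgePow (fun w => (κ w : ℂ)) (n - 1))
      (fun i => M (stdFrame n (Fin.cast (degree_eq n) i)))).re) := by
  obtain ⟨b, hb1, hb2⟩ := exists_unitary_frame κ hinv hpos
  obtain ⟨m, rfl⟩ : ∃ m, n = m + 1 := Nat.exists_eq_succ_of_ne_zero (NeZero.ne n)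
  set M : Cn (m + 1) ≃ₗ[ℂ] Cn (m + 1) := (Pi.basisFun ℂ (Fin (m + 1))).equiv b (Equiv.refl _)
  have hM : ∀ l, M (Pi.single l 1) = b l := fun l => by
    rw [← Pi.basisFun_apply, Module.Basis.equiv_apply]
    rfl
  set u : Fin (m + 1) × Fin 2 → Cn (m + 1) := fun p => ![b p.1, Complex.I • b p.1] p.2
  have hu : (fun i : Fin (2 + 2 * m) => M.toLinearMap (stdFrame (m + 1)
      (Fin.cast (degree_eq (m + 1)) i))) = fun i => u ((pairEquiv m).symm i) := by
    funext i
    rw [stdFrame_map]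
    simp only [u, LinearEquiv.coe_coe, hM]
  have hκ0 : ∀ i j : Fin (m + 1) × Fin 2, i.1 ≠ j.1 → κ ![u i, u j] = 0 := by
    rintro ⟨i, e⟩ ⟨j, f⟩ hij
    simp only [ne_eq] at hij
    fin_cases e <;> fin_cases f
    · exact hb1 i j hij
    · exact hb2 i j hij
    · exact (κ.two_swap _ _).trans (neg_eq_zero.2 (hb2 j i (Ne.symm hij)))
    · exact (hinv _ _).trans (hb1 i j hij)
  have hκ1 : ∀ l, 0 < κ ![u (l, 0), u (l, 1)] := fun l => hpos _ (b.ne_zero l)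
  have hβ1 : ∀ l, 0 ≤ β ![u (l, 0), u (l, 1)] := fun l => hβ _
  refine ⟨M, (LinearEquiv.isUnit_det' M).ne_zero, ?_, fun h => ?_⟩
  · have h1 := wedge_wedgePow_nonneg β.two_swap κ.two_swap hκ0 hκ1 hβ1
    rw [← hu] at h1
    exact h1
  · obtain ⟨l, hl⟩ := h b
    have h1 := wedge_wedgePow_pos β.two_swap κ.two_swap hκ0 hκ1 hβ1 l hl
    rw [← hu] at h1
    exact h1

/-- The sign on the diagonalising frame gives the sign on the standard frame after division by `|det
M|² > 0`; multiplication by `|det D|²` then gives any `D`, possibly degenerate. -/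
theorem topForm_nonneg : 0 ≤ (wedge (fun w => (β w : ℂ)) (wedgePow (fun w => (κ w : ℂ)) (n - 1))
    (fun i => D (stdFrame n (Fin.cast (degree_eq n) i)))).re := by
  obtain ⟨M, hM, h1, -⟩ := exists_topForm_frame hinv hpos hβ
  obtain ⟨γ, hγ⟩ := exists_topForm β κ
  rw [← hγ fun i => M (stdFrame n i), γ.map_complexLinear (by simp)] at h1
  rw [← hγ fun i => D (stdFrame n i), γ.map_complexLinear (by simp)]
  exact mul_nonneg (Complex.normSq_nonneg _)
    (nonneg_of_mul_nonneg_right h1 (Complex.normSq_pos.2 hM))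

theorem topForm_pos (hD : Function.Injective D)
    (h : ∀ b : Module.Basis (Fin n) ℂ (Cn n), ∃ l, 0 < β ![b l, Complex.I • b l]) :
    0 < (wedge (fun w => (β w : ℂ)) (wedgePow (fun w => (κ w : ℂ)) (n - 1))
      (fun i => D (stdFrame n (Fin.cast (degree_eq n) i)))).re := by
  obtain ⟨M, hM, -, h1⟩ := exists_topForm_frame hinv hpos hβ
  obtain ⟨γ, hγ⟩ := exists_topForm β κ
  have hDdet : LinearMap.det D ≠ 0 := by
    have h2 : (LinearEquiv.ofInjectiveEndo D hD).toLinearMap = D := LinearMap.ext fun _ => rfl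
    exact h2 ▸ (LinearEquiv.isUnit_det' (LinearEquiv.ofInjectiveEndo D hD)).ne_zero
  have h2 := h1 h
  rw [← hγ fun i => M (stdFrame n i), γ.map_complexLinear (by simp)] at h2
  rw [← hγ fun i => D (stdFrame n i), γ.map_complexLinear (by simp)]
  exact mul_pos (Complex.normSq_pos.2 hDdet)
    (pos_of_mul_pos_right h2 (Complex.normSq_nonneg _))

end PointwisePositivity

/-- The fibres of `E` carry a topology but no norm, so the derivative is computed in a topological
vector space; the Hausdorff property makes it unique. -/
theorem deriv_const_add_smul {V : Type*} [AddCommGroup V] [Module ℝ V] [TopologicalSpace V]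
    [IsTopologicalAddGroup V] [ContinuousSMul ℝ V] [T2Space V] (c e : V) :
    deriv (fun t : ℝ => c + t • e) 0 = e := by
  have h : HasFDerivAt (fun t : ℝ => c + t • e) (ContinuousLinearMap.toSpanSingleton ℝ e) 0 := by
    refine .of_isLittleOTVS ?_
    refine (Asymptotics.IsLittleOTVS.zero _ _).congr_left fun t => ?_
    simp
  rw [deriv, h.fderiv]
  simp

/-! ### Curvature of the universal connection and its Chern form. -/

section Curvature

variable {n : ℕ} {X : Type*} [TopologicalSpace X] [ChartedSpace (Cn n) X]
  [IsManifold 𝓘(ℂ, Cn n) ∞ X]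
  {F : Type*} [NormedAddCommGroup F] [NormedSpace ℂ F]
  {E : X → Type*} [∀ x, AddCommGroup (E x)] [∀ x, Module ℂ (E x)] [∀ x, TopologicalSpace (E x)]
  [∀ x, IsTopologicalAddGroup (E x)] [∀ x, ContinuousSMul ℝ (E x)]
  [TopologicalSpace (TotalSpace F E)] [FiberBundle F E]
  [VectorBundle ℂ F E] [VectorBundle ℝ F E] [ContMDiffVectorBundle ∞ F E 𝓘(ℝ, Cn n)]
  {h : HermitianMetric n F E}

theorem t2Space_fibre (F : Type*) [NormedAddCommGroup F] [NormedSpace ℂ F]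
    [TopologicalSpace (TotalSpace F E)] [FiberBundle F E] [VectorBundle ℝ F E] (x : X) :
    T2Space (E x) :=
  ((trivializationAt F E x).continuousLinearEquivAt ℝ x
    (mem_baseSet_trivializationAt F E x)).toHomeomorph.symm.t2Space

/-- The extension of the zero vector vanishes near the base point. -/
theorem extend_zero_eventuallyEq {F' : Type*} [NormedAddCommGroup F'] [NormedSpace ℝ F']
    {E' : X → Type*} [∀ x, AddCommGroup (E' x)] [∀ x, Module ℝ (E' x)]
    [∀ x, TopologicalSpace (E' x)] [TopologicalSpace (TotalSpace F' E')] [FiberBundle F' E']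
    [VectorBundle ℝ F' E'] (x : X) :
    ∀ᶠ y in 𝓝 x, FiberBundle.extend F' (0 : E' x) y = 0 := by
  set t := trivializationAt F' E' x
  have hx : x ∈ t.baseSet := mem_baseSet_trivializationAt F' E' x
  filter_upwards [t.open_baseSet.mem_nhds hx] with y hy
  change t.symm y (t ⟨x, 0⟩).2 = 0
  have h0 : (t ⟨x, 0⟩).2 = 0 := (t.linear ℝ hx).map_zero
  rw [h0, ← Trivialization.symmₗ_apply (R := ℝ) t hy, map_zero]

theorem diffSecAt_extend {x : X} (e : E x) : DiffSecAt n F (FiberBundle.extend F e) x := by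
  have : ContMDiffVectorBundle 1 F E 𝓘(ℝ, Cn n) := .of_le (n := ∞) (by norm_num)
  exact FiberBundle.mdifferentiableAt_extend 𝓘(ℝ, Cn n) F e

theorem deriv_const_fibre (F : Type*) [NormedAddCommGroup F] [NormedSpace ℂ F]
    [TopologicalSpace (TotalSpace F E)] [FiberBundle F E] [VectorBundle ℝ F E] {x : X} (c : E x) :
    deriv (fun _ : ℝ => c) 0 = 0 := by
  have := t2Space_fibre (E := E) F x
  simpa using deriv_const_add_smul c 0

theorem universalConnection_const (s : ∀ y : X, E y) (A : UnitaryConnection h) (x : X)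
    (u : SHForm h × RTan n x) : universalConnection (fun _ => s) A x u = A.toFun s x u.2 := by
  rw [universalConnection, deriv_const_fibre F, zero_add]

/-- Locality of the connection. It disposes of derivatives of sections contracted with the extension
of a zero vector, which vanishes near `x` but need not vanish globally. -/
theorem UnitaryConnection.eq_zero_of_eventuallyEq_zero (A : UnitaryConnection h) {x : X}
    {s : ∀ y : X, E y} (hs : ∀ᶠ y in 𝓝 x, s y = 0) : A.toFun s x = 0 := by
  by_cases hd : DiffSecAt n F s x
  · rw [A.isCovariantDerivativeOnUniv.congr_of_eventuallyEq hd
      (mdifferentiableAt_zeroSection ..) Filter.univ_mem hs]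
    exact A.isCovariantDerivativeOnUniv.zero (mem_univ x)
  · exact A.normalised s x hd

theorem mlieBracket_eq_zero_left {x : X} {V W : ∀ y : X, RTan n y}
    (hV : ∀ᶠ y in 𝓝 x, V y = 0) : VectorField.mlieBracket 𝓘(ℝ, Cn n) V W x = 0 := by
  have h1 : V =ᶠ[𝓝 x] 0 := hV
  refine (h1.mlieBracket_vectorField_eq (W := W) (W₁ := W) (I := 𝓘(ℝ, Cn n))
    Filter.EventuallyEq.rfl).trans ?_
  exact congrFun VectorField.mlieBracket_zero_left x

theorem universalCurvature_mixed (A : UnitaryConnection h) (x : X) (a : SHForm h) (v : RTan n x) :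
    universalCurvature A x (a, 0) (0, v) = a.1 x v := by
  have := t2Space_fibre (E := E) F x
  unfold universalCurvature
  refine (Module.Basis.ofVectorSpace ℂ (E x)).ext fun i => ?_
  rw [Module.Basis.constr_basis]
  simp only [universalConnection_const]
  set e := Module.Basis.ofVectorSpace ℂ (E x) i
  have hV := extend_zero_eventuallyEq (F' := Cn n) (E' := fun y : X => RTan n y) x
  rw [mlieBracket_eq_zero_left hV, map_zero, sub_zero, universalConnection, universalConnection]
  simp only [FiberBundle.extend_apply_self]
  rw [A.eq_zero_of_eventuallyEq_zero (s := fun y => A.toFun (FiberBundle.extend F e) y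
    (FiberBundle.extend (Cn n) (0 : RTan n x) y)) (hV.mono fun y hy => by rw [hy, map_zero])]
  simp only [map_zero, zero_apply]
  rw [deriv_const_fibre F, add_zero, add_zero, sub_zero]
  -- The only surviving term: `D_{A+ta}` applied to a section constant along the connections is
  -- affine in `t` with slope `a(v)e`.
  have h1 : ∀ t : ℝ, (t • a +ᵥ A).toFun (FiberBundle.extend F e) x v =
      A.toFun (FiberBundle.extend F e) x v + t • a.1 x v e := fun t => by
    rw [UnitaryConnection.vadd_apply _ _ (diffSecAt_extend e), FiberBundle.extend_apply_self]
    rfl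
  simp only [h1]
  exact deriv_const_add_smul _ _

theorem universalCurvature_swap (A : UnitaryConnection h) (x : X) (u w : SHForm h × RTan n x) :
    universalCurvature A x w u = - universalCurvature A x u w := by
  unfold universalCurvature
  refine (Module.Basis.ofVectorSpace ℂ (E x)).ext fun i => ?_
  rw [LinearMap.neg_apply, Module.Basis.constr_basis, Module.Basis.constr_basis]
  simp only [universalConnection_const]
  rw [VectorField.mlieBracket_swap_apply, map_neg]
  abel

theorem universalCurvature_vertical (A : UnitaryConnection h) (x : X) (a b : SHForm h) :
    universalCurvature A x (a, 0) (b, 0) = 0 := by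
  unfold universalCurvature
  refine (Module.Basis.ofVectorSpace ℂ (E x)).ext fun i => ?_
  rw [Module.Basis.constr_basis]
  have hV := extend_zero_eventuallyEq (F' := Cn n) (E' := fun y : X => RTan n y) x
  simp only [universalConnection_const]
  rw [mlieBracket_eq_zero_left hV, map_zero, sub_zero, universalConnection, universalConnection]
  simp only [FiberBundle.extend_apply_self, map_zero, add_zero]
  rw [deriv_const_fibre F, sub_zero, LinearMap.zero_apply]

/-- Cyclicity of the trace merges the four products into two, and the resulting factor `2` cancels
`1/2!`. -/
theorem trace_contract {V : Type*} [AddCommGroup V] [Module ℂ V] (S₀ S₁ T₀ T₁ : Module.End ℂ V)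
    (k : ℂ) : LinearMap.trace ℂ V ((1 / (Nat.factorial 2 : ℂ)) •
      ((k • S₁) * (k • T₀) + (k • T₀) * (k • S₁) - (k • S₀) * (k • T₁) - (k • T₁) * (k • S₀))) =
      -(k * k) * LinearMap.trace ℂ V (S₀ * T₁ - S₁ * T₀) := by
  simp only [smul_mul_smul_comm, map_smul, map_sub, map_add, Nat.factorial_two]
  rw [LinearMap.trace_mul_comm ℂ T₀, LinearMap.trace_mul_comm ℂ T₁]
  simp only [smul_eq_mul]
  push_cast
  ring

theorem universalChernForm_apply (A : UnitaryConnection h) (x : X)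
    (w : Fin (2 + 2) → SHForm h × RTan n x) :
    universalChernForm A x w = LinearMap.trace ℂ (E x) ((1 / (Nat.factorial 2 : ℂ)) •
      wedge (p := 2) (q := 2)
        (fun w => (Complex.I / (2 * (Real.pi : ℂ))) • universalCurvature A x (w 0) (w 1))
        (fun w => (Complex.I / (2 * (Real.pi : ℂ))) • universalCurvature A x (w 0) (w 1)) w) := by
  unfold universalChernForm
  dsimp only

theorem traceWedge_apply (a b : SHForm h) (x : X) (v : Fin 2 → RTan n x) :
    traceWedge a b x v =
      LinearMap.trace ℂ (E x) (a.1 x (v 0) * b.1 x (v 1) - a.1 x (v 1) * b.1 x (v 0)) := by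
  rw [← wedge_one_one (fun v => a.1 x v) (fun v => b.1 x v) v]
  rfl

theorem universalChernForm_contract (A : UnitaryConnection h) (x : X) (a b : SHForm h)
    (v : Fin 2 → RTan n x) :
    universalChernForm A x ![(a, 0), (b, 0), (0, v 0), (0, v 1)] =
      (1 / (4 * (Real.pi : ℂ) ^ 2)) * traceWedge a b x v := by
  set k : ℂ := Complex.I / (2 * (Real.pi : ℂ)) with hk
  have h1 := wedge_two_two (T := SHForm h × RTan n x)
    (c := fun u w => k • universalCurvature A x u w) (a := (a, 0)) (b := (b, 0))
    (x := (0, v 0)) (y := (0, v 1)) (A := fun u => k • a.1 x u.2) (B := fun u => k • b.1 x u.2)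
    (by rw [universalCurvature_vertical, smul_zero])
    (by rw [universalCurvature_vertical, smul_zero])
    (by rw [universalCurvature_mixed]) (by
      rw [universalCurvature_swap A x (a, 0), universalCurvature_mixed, smul_neg])
    (by rw [universalCurvature_mixed]) (by
      rw [universalCurvature_swap A x (a, 0), universalCurvature_mixed, smul_neg])
    (by rw [universalCurvature_mixed]) (by
      rw [universalCurvature_swap A x (b, 0), universalCurvature_mixed, smul_neg])
    (by rw [universalCurvature_mixed]) (by
      rw [universalCurvature_swap A x (b, 0), universalCurvature_mixed, smul_neg])
  -- The minus sign from the order of the arguments cancels `i² = -1`.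
  have h3 : 1 / (4 * (Real.pi : ℂ) ^ 2) = -(k * k) := by
    have : (Real.pi : ℂ) ≠ 0 := Complex.ofReal_ne_zero.2 Real.pi_ne_zero
    rw [hk, div_mul_div_comm, Complex.I_mul_I]
    field_simp
    norm_num
  rw [h3]
  rw [universalChernForm_apply, h1, trace_contract, traceWedge_apply]

theorem universalChernForm_perm (A : UnitaryConnection h) (x : X)
    (τ : Equiv.Perm (Fin 4)) (w : Fin 4 → SHForm h × RTan n x) :
    universalChernForm A x (fun i => w (τ i)) =
      (Equiv.Perm.sign τ : ℤ) • universalChernForm A x w := by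
  rw [universalChernForm_apply, universalChernForm_apply, wedge_perm, smul_comm, map_zsmul]

/-- Contracting an antisymmetric function with a vector leaves it antisymmetric. -/
theorem contract_perm {T M : Type*} [AddCommGroup M] {p : ℕ} {α : (Fin (p + 1) → T) → M}
    (hα : ∀ (τ : Equiv.Perm (Fin (p + 1))) v, α (fun i => v (τ i)) = (Equiv.Perm.sign τ : ℤ) • α v)
    (u : T) (τ : Equiv.Perm (Fin p)) (v : Fin p → T) :
    α (Fin.cons u fun i => v (τ i)) = (Equiv.Perm.sign τ : ℤ) • α (Fin.cons u v) := by
  have h1 := hα (Equiv.Perm.decomposeFin.symm (0, τ)) (Fin.cons u v)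
  rw [Equiv.Perm.decomposeFin.symm_sign, if_pos rfl, one_mul] at h1
  rw [← h1]
  congr 1
  funext i
  refine Fin.cases ?_ (fun j => ?_) i <;> simp

theorem append_eq_cons {T : Type*} {N q : ℕ} (a b : T) (v : Fin N → T) (hN : 2 + q = N)
    (h0 : 2 + 2 + q = 2 + N) (h1 : 3 + 1 + q = 3 + q + 1) (h2 : 2 + 1 + q = 2 + q + 1)
    (i : Fin (2 + 2 + q)) :
    Fin.append ![a, b] v (Fin.cast h0 i) = (Fin.cons a (fun i => (Fin.cons b
      (fun i => v (Fin.cast hN i)) : Fin (2 + q + 1) → T) (Fin.cast h2 i)) :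
        Fin (3 + q + 1) → T) (Fin.cast h1 i) := by
  subst hN
  obtain ⟨i, hi⟩ := i
  match i, hi with
  | 0, hi =>
    have : Fin.cast h0 ⟨0, hi⟩ = Fin.castAdd (2 + q) 0 := rfl
    rw [this, Fin.append_left]
    rfl
  | 1, hi =>
    have : Fin.cast h0 ⟨1, hi⟩ = Fin.castAdd (2 + q) 1 := rfl
    rw [this, Fin.append_left]
    rfl
  | k + 2, hi =>
    have : Fin.cast h0 ⟨k + 2, hi⟩ = Fin.natAdd 2 ⟨k, by omega⟩ := Fin.ext (Nat.add_comm k 2)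
    rw [this, Fin.append_right]
    rfl

variable [T2Space X] [CompactSpace X]

theorem integralTop_const_mul (c : ℂ) (η : ∀ x : X, (Fin (2 * n) → RTan n x) → ℂ) :
    integralTop (fun x v => c * η x v) = c * integralTop η := by
  unfold integralTop
  rw [← smul_eq_mul c, smul_finsum]
  refine finsum_congr fun i => ?_
  rw [← integral_smul]
  congr 1
  funext y
  rw [smul_eq_mul]
  ring

variable [NeZero n] (κ : KahlerForm n X)

theorem fibreChernForm_eq (A : UnitaryConnection h) (a b : SHForm h) :
    fibreChernForm κ A ![a, b] = (1 / (4 * (Real.pi : ℂ) ^ 2)) * traceIntegral κ a b := by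
  unfold fibreChernForm fibreIntegral traceIntegral
  rw [← integralTop_const_mul]
  congr 1
  funext x v
  set c : ℂ := 1 / (4 * (Real.pi : ℂ) ^ 2)
  set T := SHForm h × RTan n x
  set β : (Fin (2 * (n - 1)) → T) → ℂ :=
    wedgePow (fun w' : Fin 2 → T => (κ.form x (fun i => (w' i).2) : ℂ)) (n - 1) with hβdef
  -- `κ` is pulled back from `X`, so vertical vectors are in its kernel. This permits contraction
  -- with `(a, 0)` and then `(b, 0)` on the Chern factor alone.
  have hβ : ∀ (d : SHForm h) (w : Fin (2 * (n - 1)) → T) j, w j = (d, 0) → β w = 0 := by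
    intro d w j hj
    refine wedgePow_eq_zero (u := ((d, 0) : T)) (fun w' j' hj' => ?_) (n - 1) w j hj
    rw [(κ.form x).map_coord_zero (m := fun i => (w' i).2) j' (by rw [hj'])]
    exact Complex.ofReal_zero
  have hw : (fun i : Fin (2 + 2 + 2 * (n - 1)) => (Fin.append (fun i => ((![a, b] i, 0) : T))
      (fun j => ((0, v j) : T)) (Fin.cast (degree_eq₁ n) i))) =
      fun i => (Fin.cons ((a, 0) : T) (fun i => (Fin.cons ((b, 0) : T)
        (fun i => (0, v (Fin.cast (degree_eq n) i))) : Fin (2 + 2 * (n - 1) + 1) → T)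
          (Fin.cast (by omega) i)) : Fin (3 + 2 * (n - 1) + 1) → T) (Fin.cast (by omega) i) := by
    funext i
    have h1 : (fun i => ((![a, b] i, 0) : T)) = ![(a, 0), (b, 0)] := by
      funext i
      fin_cases i <;> rfl
    rw [h1]
    exact append_eq_cons _ _ _ (degree_eq n) _ _ _ i
  have hα := contract_perm (p := 3) (universalChernForm_perm A x) ((a, 0) : T)
  refine (congrArg (wedge (universalChernForm A x) β) hw).trans ?_
  refine (wedge_cons (p := 3) (universalChernForm_perm A x) (hβ a) _ _).trans ?_
  refine (wedge_cons (p := 2) hα (hβ b) _ _).trans ?_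
  have hβ' : β = fun w => wedgePow (fun w : Fin 2 → RTan n x => (κ.form x w : ℂ)) (n - 1)
      (fun i => (w i).2) :=
    funext fun w => wedgePow_comp (T' := T) (fun u : T => u.2)
      (fun w : Fin 2 → RTan n x => (κ.form x w : ℂ)) (n - 1) w
  rw [hβ']
  refine (wedge_congr_left (α' := fun w => c • traceWedge a b x (fun i => (w i).2))
    fun σ => ?_).trans ?_
  · rw [smul_eq_mul, ← universalChernForm_contract A]
    congr 1
    funext i
    fin_cases i <;> rfl
  · exact wedge_const_smul_left c _ _ _

end Curvature

/-! ### Holomorphic charts and their differentials. -/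

section Charts

variable {n : ℕ} {X : Type*} [TopologicalSpace X] [ChartedSpace (Cn n) X]
  [IsManifold 𝓘(ℂ, Cn n) ∞ X]

theorem chartParam_mem_source {i : X} {y : Cn n} (hy : y ∈ (extChartAt 𝓘(ℝ, Cn n) i).target) :
    chartParam n i y ∈ (chartAt (Cn n) i).source := by
  have := (extChartAt 𝓘(ℝ, Cn n) i).map_target hy
  rwa [extChartAt_source] at this

theorem chartParamDeriv_eq_symmL {i : X} {y : Cn n}
    (hy : y ∈ (extChartAt 𝓘(ℝ, Cn n) i).target) :
    chartParamDeriv n i y =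
      (trivializationAt (Cn n) (TangentSpace 𝓘(ℝ, Cn n)) i).symmL ℝ (chartParam n i y) := by
  have : IsManifold 𝓘(ℝ, Cn n) 1 X := .of_le (n := ∞) (by norm_num)
  rw [TangentBundle.symmL_trivializationAt (chartParam_mem_source hy),
    (extChartAt 𝓘(ℝ, Cn n) i).right_inv hy, modelWithCornersSelf_coe, range_id, mfderivWithin_univ]

/-- `tanJ` at a point is multiplication by `i` in the preferred chart there; the transition from
chart `i` is holomorphic, so its real derivative comes from a complex-linear one. -/
theorem chartParamDeriv_I_smul {i : X} {y : Cn n} (hy : y ∈ (extChartAt 𝓘(ℝ, Cn n) i).target)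
    (v : Cn n) : chartParamDeriv n i y (Complex.I • v) = tanJ _ (chartParamDeriv n i y v) := by
  have : IsManifold 𝓘(ℝ, Cn n) 1 X := .of_le (n := ∞) (by norm_num)
  have hs := chartParam_mem_source hy
  set x := chartParam n i y with hx
  have hd : DifferentiableAt ℂ (extChartAt 𝓘(ℂ, Cn n) x ∘ (extChartAt 𝓘(ℂ, Cn n) i).symm)
      (extChartAt 𝓘(ℂ, Cn n) i x) := by
    have := (contDiffWithinAt_ext_coord_change (I := 𝓘(ℂ, Cn n)) (n := ∞) (M := X) x i
      (y := extChartAt 𝓘(ℂ, Cn n) i x) (by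
        simp [hs])).differentiableWithinAt (by simp)
    rw [modelWithCornersSelf_coe, range_id] at this
    exact differentiableWithinAt_univ.1 this
  have h3 : ∀ v : Cn n, tangentCoordChange 𝓘(ℝ, Cn n) i x x v =
      fderiv ℂ (extChartAt 𝓘(ℂ, Cn n) x ∘ (extChartAt 𝓘(ℂ, Cn n) i).symm)
        (extChartAt 𝓘(ℂ, Cn n) i x) v := by
    intro v
    rw [tangentCoordChange_def]
    have := hd.fderiv_restrictScalars ℝ
    simp only [modelWithCornersSelf_coe, range_id, fderivWithin_univ]
    exact congrArg (fun L : Cn n →L[ℝ] Cn n => L v) this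
  have h4 : ∀ v : Cn n, chartParamDeriv n i y v = tangentCoordChange 𝓘(ℝ, Cn n) i x x v := by
    intro v
    rw [chartParamDeriv_eq_symmL hy, TangentBundle.symmL_trivializationAt_eq_core hs]
    rfl
  rw [h4, h4, h3, h3]
  exact (fderiv ℂ (extChartAt 𝓘(ℂ, Cn n) x ∘ (extChartAt 𝓘(ℂ, Cn n) i).symm)
    (extChartAt 𝓘(ℂ, Cn n) i x)).map_smul _ _

theorem chartParamDeriv_injective {i : X} {y : Cn n}
    (hy : y ∈ (extChartAt 𝓘(ℝ, Cn n) i).target) :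
    Function.Injective (chartParamDeriv n i y) := by
  rw [chartParamDeriv_eq_symmL hy]
  refine Function.LeftInverse.injective (g := (trivializationAt (Cn n)
    (TangentSpace 𝓘(ℝ, Cn n)) i).continuousLinearMapAt ℝ (chartParam n i y)) fun v => ?_
  exact Bundle.Trivialization.continuousLinearMapAt_symmL _ (by
    simpa using chartParam_mem_source hy) v

/-- A constant vector in a chart extends to a smooth vector field. -/
theorem smoothFieldAt_symmL {i x : X} (hx : x ∈ (chartAt (Cn n) i).source) (v : Cn n) :
    SmoothFieldAt (fun z : X => ((trivializationAt (Cn n) (TangentSpace 𝓘(ℝ, Cn n)) i).symmL ℝ z v :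
      RTan n z)) x := by
  set t := trivializationAt (Cn n) (TangentSpace 𝓘(ℝ, Cn n) : X → Type _) i
  have hxt : x ∈ t.baseSet := by simpa [t] using hx
  refine (t.contMDiffAt_section_iff hxt).2 ?_
  refine (contMDiffAt_const (c := v)).congr_of_eventuallyEq ?_
  filter_upwards [t.open_baseSet.mem_nhds hxt] with z hz
  rw [Bundle.Trivialization.symmL_apply t hz, t.apply_mk_symm hz]

end Charts

/-! ### Continuity of the integrands in charts. -/

section Continuity

variable {n : ℕ} {X : Type*} [TopologicalSpace X] [ChartedSpace (Cn n) X]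
  [IsManifold 𝓘(ℂ, Cn n) ∞ X]
  {F : Type*} [NormedAddCommGroup F] [NormedSpace ℂ F] [FiniteDimensional ℂ F]
  {E : X → Type*} [∀ x, AddCommGroup (E x)] [∀ x, Module ℂ (E x)] [∀ x, TopologicalSpace (E x)]
  [∀ x, IsTopologicalAddGroup (E x)] [∀ x, ContinuousSMul ℝ (E x)]
  [TopologicalSpace (TotalSpace F E)] [FiberBundle F E]
  [VectorBundle ℂ F E] [VectorBundle ℝ F E] [ContMDiffVectorBundle ∞ F E 𝓘(ℝ, Cn n)]
  {h : HermitianMetric n F E}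

/-- Smoothness of `a` and `b` is only known through their action on smooth sections, so the trace is
written near `x₀` as the sum of the diagonal coordinates of `a(V)b(W)` on a local frame. -/
theorem continuousAt_trace (a b : SHForm h) {V W : ∀ y : X, RTan n y} {x₀ : X}
    (hV : SmoothFieldAt V x₀) (hW : SmoothFieldAt W x₀) :
    ContinuousAt (fun x => LinearMap.trace ℂ (E x) (a.1 x (V x) * b.1 x (W x))) x₀ := by
  set t := trivializationAt F E x₀
  set f := Module.finBasis ℂ F
  have hx₀ : x₀ ∈ t.baseSet := mem_baseSet_trivializationAt F E x₀
  set s : Fin (Module.finrank ℂ F) → ∀ y : X, E y := fun j y => FiberBundle.extend F (t.symm x₀ (f j)) y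
  have hs : ∀ j, SmoothSecAt n F (s j) x₀ := fun j =>
    FiberBundle.contMDiffAt_extend (k := ∞) 𝓘(ℝ, Cn n) F (t.symm x₀ (f j))
  have hσ : ∀ j, SmoothSecAt n F (fun y => a.1 y (V y) (b.1 y (W y) (s j y))) x₀ := fun j =>
    a.2.2 _ V x₀ (b.2.2 (s j) W x₀ (hs j) hW) hV
  have hc : ContinuousAt (fun x => ∑ j, f.coord j
      (t ⟨x, a.1 x (V x) (b.1 x (W x) (s j x))⟩).2) x₀ := by
    refine tendsto_finsetSum _ fun j _ => ?_
    have h1 := ((contMDiffAt_section (F := F) (E := E) x₀).1 (hσ j)).continuousAt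
    exact (LinearMap.continuous_of_finiteDimensional (f.coord j)).continuousAt.comp h1
  refine hc.congr ?_
  filter_upwards [t.open_baseSet.mem_nhds hx₀] with x hx
  -- On the base set of `t`, the sections extended from `x₀` are the frame given by the
  -- trivialisation.
  have hsx : ∀ j, s j x = t.symm x (f j) := fun j => by
    simp only [s, FiberBundle.extend]
    rw [t.apply_mk_symm hx₀]
  rw [← LinearMap.trace_conj' _ (t.linearEquivAt ℂ x hx), LinearMap.trace_eq_matrix_trace ℂ f]
  refine Finset.sum_congr rfl fun j _ => ?_
  rw [Matrix.diag_apply, LinearMap.toMatrix_apply, hsx]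
  rfl

theorem continuousOn_traceWedge (a b : SHForm h) (i : X) (u : Fin 2 → Cn n) :
    ContinuousOn (fun y => traceWedge a b (chartParam n i y)
      (fun k => chartParamDeriv n i y (u k))) (extChartAt 𝓘(ℝ, Cn n) i).target := by
  set V : Cn n → ∀ z : X, RTan n z := fun v z =>
    (trivializationAt (Cn n) (TangentSpace 𝓘(ℝ, Cn n)) i).symmL ℝ z v
  have key : ∀ v w : Cn n, ContinuousOn (fun y => LinearMap.trace ℂ (E (chartParam n i y))
      (a.1 _ (chartParamDeriv n i y v) * b.1 _ (chartParamDeriv n i y w)))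
      (extChartAt 𝓘(ℝ, Cn n) i).target := by
    intro v w y hy
    have hx := chartParam_mem_source hy
    have h1 := continuousAt_trace a b (smoothFieldAt_symmL hx v) (smoothFieldAt_symmL hx w)
    have h2 : ContinuousWithinAt (chartParam n i) (extChartAt 𝓘(ℝ, Cn n) i).target y :=
      continuousOn_extChartAt_symm i y hy
    refine (ContinuousAt.comp_continuousWithinAt (f := chartParam n i) (g := fun x =>
      LinearMap.trace ℂ (E x) (a.1 x (V v x) * b.1 x (V w x))) h1 h2).congr
        (fun z hz => ?_) ?_
    · simp only [Function.comp, V, chartParamDeriv_eq_symmL hz]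
    · simp only [Function.comp, V, chartParamDeriv_eq_symmL hy]
  simp only [traceWedge_apply, map_sub]
  exact (key _ _).sub (key _ _)

theorem continuousOn_kahlerForm (κ : KahlerForm n X) (i : X) (u : Fin 2 → Cn n) :
    ContinuousOn (fun y => (κ.form (chartParam n i y) (fun k => chartParamDeriv n i y (u k)) : ℂ))
      (extChartAt 𝓘(ℝ, Cn n) i).target := by
  refine Complex.continuous_ofReal.comp_continuousOn ?_
  have h1 := (κ.smooth i).continuousOn
  exact (ContinuousAlternatingMap.apply ℝ (Cn n) ℝ u).continuous.comp_continuousOn h1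

/-- A wedge product depends continuously on parameters if its factors do. -/
theorem continuousOn_wedge {Y R : Type*} [TopologicalSpace Y] {T : Y → Type*} {S : Set Y} {p q : ℕ}
    {α : ∀ y, (Fin p → T y) → ℂ} {β : ∀ y, (Fin q → T y) → ℂ} {v : ∀ y, R → T y}
    (hα : ∀ u : Fin p → R, ContinuousOn (fun y => α y (fun k => v y (u k))) S)
    (hβ : ∀ u : Fin q → R, ContinuousOn (fun y => β y (fun k => v y (u k))) S)
    (u : Fin (p + q) → R) :
    ContinuousOn (fun y => wedge (α y) (β y) (fun k => v y (u k))) S := by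
  unfold wedge
  refine ContinuousOn.const_smul (M := ℂ) (α := ℂ) ?_ _
  refine continuousOn_finsetSum _ fun σ _ => ?_
  exact ContinuousOn.const_smul (M := ℤ) (α := ℂ) ((hα _).mul (hβ _)) _

theorem continuousOn_wedgePow {Y R : Type*} [TopologicalSpace Y] {T : Y → Type*} {S : Set Y}
    {α : ∀ y, (Fin 2 → T y) → ℂ} {v : ∀ y, R → T y}
    (hα : ∀ u : Fin 2 → R, ContinuousOn (fun y => α y (fun k => v y (u k))) S) (k : ℕ)
    (u : Fin (2 * k) → R) :
    ContinuousOn (fun y => wedgePow (α y) k (fun k => v y (u k))) S := by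
  induction k with
  | zero => exact continuousOn_const
  | succ k ih => exact continuousOn_wedge ih hα u

theorem continuousOn_topForm [NeZero n] (κ : KahlerForm n X) (a b : SHForm h) (i : X) :
    ContinuousOn (fun y => wedge (traceWedge a b (chartParam n i y))
      (wedgePow (fun w : Fin 2 → RTan n (chartParam n i y) => (κ.form (chartParam n i y) w : ℂ))
        (n - 1)) (fun k => chartParamDeriv n i y (stdFrame n (Fin.cast (degree_eq₂ n) k))))
      (extChartAt 𝓘(ℝ, Cn n) i).target :=
  continuousOn_wedge (v := fun y => chartParamDeriv n i y) (continuousOn_traceWedge a b i)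
    (continuousOn_wedgePow (v := fun y => chartParamDeriv n i y) (continuousOn_kahlerForm κ i) _) _

end Continuity

/-! ### Integration of continuous top forms. -/

section Integration

variable {n : ℕ} {X : Type*} [TopologicalSpace X] [ChartedSpace (Cn n) X]
  [IsManifold 𝓘(ℂ, Cn n) ∞ X] [T2Space X] [CompactSpace X]

theorem chartPartition_tsupport (i : X) :
    tsupport (chartPartition n X i) ⊆ (chartAt (Cn n) i).source :=
  (SmoothPartitionOfUnity.exists_isSubordinate_chartAt_source 𝓘(ℝ, Cn n) X).choose_spec i

theorem chartPartition_finite :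
    {i : X | (Function.support (chartPartition n X i)).Nonempty}.Finite :=
  (chartPartition n X).locallyFinite.finite_nonempty_of_compact

/-- The form `η` of top degree is continuous in the preferred charts. -/
def ContinuousTop (η : ∀ x : X, (Fin (2 * n) → RTan n x) → ℂ) : Prop :=
  ∀ i : X, ContinuousOn (fun y => η (chartParam n i y)
    (fun k => chartParamDeriv n i y (stdFrame n k))) (extChartAt 𝓘(ℝ, Cn n) i).target

/-- The part of the integral over `X` cut out by the member `i` of the partition of unity. -/
def chartIntegrand (η : ∀ x : X, (Fin (2 * n) → RTan n x) → ℂ) (i : X) (y : Cn n) : ℂ :=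
  ((chartPartition n X i (chartParam n i y) : ℝ) : ℂ) *
    η (chartParam n i y) (fun k => chartParamDeriv n i y (stdFrame n k))

theorem integralTop_eq (η : ∀ x : X, (Fin (2 * n) → RTan n x) → ℂ) :
    integralTop η = ∑ᶠ i : X, ∫ y in (extChartAt 𝓘(ℝ, Cn n) i).target, chartIntegrand η i y := rfl

variable {η η' : ∀ x : X, (Fin (2 * n) → RTan n x) → ℂ}

theorem continuousOn_chartIntegrand (hη : ContinuousTop η) (i : X) :
    ContinuousOn (chartIntegrand η i) (extChartAt 𝓘(ℝ, Cn n) i).target :=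
  (Complex.continuous_ofReal.comp_continuousOn
    ((chartPartition n X i).contMDiff.continuous.comp_continuousOn
      (continuousOn_extChartAt_symm i))).mul (hη i)

/-- The partition function has compact support inside the chart, so the integrand is continuous on a
compact set and zero elsewhere. Additivity and the passage to real parts depend on this, as the
integral of a nonintegrable function is `0` by convention. -/
theorem integrableOn_chartIntegrand (hη : ContinuousTop η) (i : X) :
    IntegrableOn (chartIntegrand η i) (extChartAt 𝓘(ℝ, Cn n) i).target := by
  set K : Set (Cn n) := extChartAt 𝓘(ℝ, Cn n) i '' tsupport (chartPartition n X i)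
  have hsub : tsupport (chartPartition n X i) ⊆ (extChartAt 𝓘(ℝ, Cn n) i).source := by
    rw [extChartAt_source]
    exact chartPartition_tsupport i
  have hK : IsCompact K := (isClosed_tsupport _).isCompact.image_of_continuousOn
    ((continuousOn_extChartAt i).mono hsub)
  have hKt : K ⊆ (extChartAt 𝓘(ℝ, Cn n) i).target := by
    rintro _ ⟨x, hx, rfl⟩
    exact (extChartAt 𝓘(ℝ, Cn n) i).map_source (hsub hx)
  refine IntegrableOn.of_forall_sdiff_eq_zero
    (((continuousOn_chartIntegrand hη i).mono hKt).integrableOn_compact hK)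
    (isOpen_extChartAt_target i).measurableSet fun y hy => ?_
  have h0 : chartPartition n X i (chartParam n i y) = 0 := by
    by_contra hne
    exact hy.2 ⟨chartParam n i y, subset_tsupport _ hne, (extChartAt 𝓘(ℝ, Cn n) i).right_inv hy.1⟩
  rw [chartIntegrand, h0, Complex.ofReal_zero, zero_mul]

/-- By compactness only finitely many partition functions are nonzero, so the sum over charts is not
the default value `0` of an infinite `finsum`. -/
theorem finite_support_integral (η : ∀ x : X, (Fin (2 * n) → RTan n x) → ℂ) :
    (Function.support fun i : X =>
      ∫ y in (extChartAt 𝓘(ℝ, Cn n) i).target, chartIntegrand η i y).Finite := by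
  refine (chartPartition_finite (n := n)).subset fun i hi => ?_
  by_contra hne
  refine hi ?_
  have h0 : ∀ x, chartPartition n X i x = 0 := fun x => by
    by_contra hx
    exact hne ⟨x, hx⟩
  simp [chartIntegrand, h0]

theorem integralTop_add (hη : ContinuousTop η) (hη' : ContinuousTop η') :
    integralTop (fun x v => η x v + η' x v) = integralTop η + integralTop η' := by
  rw [integralTop_eq, integralTop_eq, integralTop_eq,
    ← finsum_add_distrib (finite_support_integral η) (finite_support_integral η')]
  refine finsum_congr fun i => ?_
  rw [← integral_add (integrableOn_chartIntegrand hη i) (integrableOn_chartIntegrand hη' i)]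
  congr 1
  funext y
  exact mul_add _ _ _

theorem integralTop_re (hη : ContinuousTop η) :
    (integralTop η).re = ∑ᶠ i : X, ∫ y in (extChartAt 𝓘(ℝ, Cn n) i).target,
      (chartIntegrand η i y).re := by
  rw [integralTop_eq]
  refine (AddMonoidHom.map_finsum Complex.reAddGroupHom (finite_support_integral η)).trans ?_
  refine finsum_congr fun i => ?_
  exact (integral_re (integrableOn_chartIntegrand hη i)).symm

theorem integralTop_im (hη : ContinuousTop η) (h0 : ∀ x v, (η x v).im = 0) :
    (integralTop η).im = 0 := by
  rw [integralTop_eq]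
  refine (AddMonoidHom.map_finsum Complex.imAddGroupHom (finite_support_integral η)).trans ?_
  refine (finsum_congr fun i => ?_).trans finsum_zero
  have h1 : ∀ y, RCLike.im (chartIntegrand η i y) = 0 := fun y =>
    (Complex.im_ofReal_mul _ _).trans (by rw [h0, mul_zero])
  refine (integral_im (integrableOn_chartIntegrand hη i)).symm.trans ?_
  simp only [h1, integral_zero]

theorem integralTop_re_pos (hη : ContinuousTop η)
    (hnn : ∀ (i : X), ∀ y ∈ (extChartAt 𝓘(ℝ, Cn n) i).target, 0 ≤ (η (chartParam n i y)
      (fun k => chartParamDeriv n i y (stdFrame n k))).re) (x₀ : X)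
    (hpos : ∀ (i : X), ∀ y ∈ (extChartAt 𝓘(ℝ, Cn n) i).target, chartParam n i y = x₀ →
      0 < (η (chartParam n i y) (fun k => chartParamDeriv n i y (stdFrame n k))).re) :
    0 < (integralTop η).re := by
  have hre : ∀ i y, (chartIntegrand η i y).re = chartPartition n X i (chartParam n i y) *
      (η (chartParam n i y) (fun k => chartParamDeriv n i y (stdFrame n k))).re := fun i y =>
    Complex.re_ofReal_mul _ _
  have hnn' : ∀ i, ∀ y ∈ (extChartAt 𝓘(ℝ, Cn n) i).target, 0 ≤ (chartIntegrand η i y).re :=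
    fun i y hy => by
      rw [hre]
      exact mul_nonneg ((chartPartition n X).nonneg _ _) (hnn i y hy)
  have hmeas : ∀ i : X, MeasurableSet (extChartAt 𝓘(ℝ, Cn n) i).target := fun i =>
    (isOpen_extChartAt_target i).measurableSet
  rw [integralTop_re hη]
  refine finsum_pos (fun i => setIntegral_nonneg (hmeas i) (hnn' i)) ?_ ?_
  -- In a chart whose partition function is positive at `x₀`, the integrand is positive on a
  -- nonempty open set, which has positive Lebesgue measure.
  · obtain ⟨i, hi⟩ := (chartPartition n X).exists_pos_of_mem (mem_univ x₀)
    refine ⟨i, ?_⟩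
    set U := (extChartAt 𝓘(ℝ, Cn n) i).target
    have hx₀ : x₀ ∈ (extChartAt 𝓘(ℝ, Cn n) i).source := by
      rw [extChartAt_source]
      exact chartPartition_tsupport i (subset_tsupport _ hi.ne')
    set y₀ := extChartAt 𝓘(ℝ, Cn n) i x₀
    have hy₀ : y₀ ∈ U := (extChartAt 𝓘(ℝ, Cn n) i).map_source hx₀
    have hp : chartParam n i y₀ = x₀ := (extChartAt 𝓘(ℝ, Cn n) i).left_inv hx₀
    have hc : ContinuousOn (fun y => (chartIntegrand η i y).re) U :=
      Complex.continuous_re.comp_continuousOn (continuousOn_chartIntegrand hη i)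
    have h0 : 0 < (chartIntegrand η i y₀).re := by
      rw [hre, hp]
      have h1 := hpos i y₀ hy₀ hp
      rw [hp] at h1
      exact mul_pos hi h1
    rw [setIntegral_pos_iff_support_of_nonneg_ae
      ((ae_restrict_iff' (hmeas i)).2 (Eventually.of_forall (hnn' i)))
      (integrableOn_chartIntegrand hη i).re]
    refine (IsOpen.measure_pos volume (hc.isOpen_inter_preimage (isOpen_extChartAt_target i)
      isOpen_Ioi (t := Ioi 0)) ⟨y₀, hy₀, h0⟩).trans_le (measure_mono ?_)
    rintro y ⟨hy, hy'⟩
    exact ⟨(ne_of_gt hy' : (chartIntegrand η i y).re ≠ 0), hy⟩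
  · refine (chartPartition_finite (n := n)).subset fun i hi => ?_
    by_contra hne
    refine hi ?_
    have h0 : ∀ x, chartPartition n X i x = 0 := fun x => by
      by_contra hx
      exact hne ⟨x, hx⟩
    simp [hre, h0]

end Integration

/-! ### The Atiyah–Bott form and its Kähler properties. -/

section AtiyahBott

variable {n : ℕ} {X : Type*} [TopologicalSpace X] [ChartedSpace (Cn n) X]
  [IsManifold 𝓘(ℂ, Cn n) ∞ X]
  {F : Type*} [NormedAddCommGroup F] [NormedSpace ℂ F] [FiniteDimensional ℂ F]
  {E : X → Type*} [∀ x, AddCommGroup (E x)] [∀ x, Module ℂ (E x)] [∀ x, TopologicalSpace (E x)]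
  [∀ x, IsTopologicalAddGroup (E x)] [∀ x, ContinuousSMul ℝ (E x)]
  [TopologicalSpace (TotalSpace F E)] [FiberBundle F E]
  [VectorBundle ℂ F E] [VectorBundle ℝ F E] [ContMDiffVectorBundle ∞ F E 𝓘(ℝ, Cn n)]
  {h : HermitianMetric n F E}

theorem finiteDimensional_fibre (F : Type*) [NormedAddCommGroup F] [NormedSpace ℂ F]
    [FiniteDimensional ℂ F] [TopologicalSpace (TotalSpace F E)] [FiberBundle F E]
    [VectorBundle ℂ F E] (x : X) : FiniteDimensional ℂ (E x) :=
  ((trivializationAt F E x).linearEquivAt ℂ x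
    (mem_baseSet_trivializationAt F E x)).symm.finiteDimensional

theorem trace_mul_im (a b : SHForm h) (x : X) (v w : RTan n x) :
    (LinearMap.trace ℂ (E x) (a.1 x v * b.1 x w)).im = 0 := by
  have := finiteDimensional_fibre (E := E) F x
  exact trace_mul_skew_im (B := fun e f => h.inner x e f) (h.conj_symm x)
    (fun e f g => map_add _ _ _) (fun c e f => map_smul _ _ _) (h.positive x) (a.2.1 x v)
    (b.2.1 x w)

theorem trace_sq_nonpos (a : SHForm h) (x : X) (v : RTan n x) :
    (LinearMap.trace ℂ (E x) (a.1 x v * a.1 x v)).re ≤ 0 := by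
  have := finiteDimensional_fibre (E := E) F x
  exact trace_sq_skew_nonpos (B := fun e f => h.inner x e f) (h.conj_symm x)
    (fun e f g => map_add _ _ _) (fun c e f => map_smul _ _ _) (h.positive x) (a.2.1 x v)

theorem trace_sq_neg (a : SHForm h) (x : X) {v : RTan n x} (hv : a.1 x v ≠ 0) :
    (LinearMap.trace ℂ (E x) (a.1 x v * a.1 x v)).re < 0 := by
  have := finiteDimensional_fibre (E := E) F x
  exact trace_sq_skew_neg (B := fun e f => h.inner x e f) (h.conj_symm x)
    (fun e f g => map_add _ _ _) (fun c e f => map_smul _ _ _) (h.positive x) (a.2.1 x v) hv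

/-- The real 2-form `-tr(a ∧ b)` on `X`. -/
def realTraceForm (a b : SHForm h) (x : X) : RTan n x [⋀^Fin 2]→ₗ[ℝ] ℝ :=
  LinearMap.toAlternatingTwo (LinearMap.mk₂ ℝ (fun v w => -(LinearMap.trace ℂ (E x)
      (a.1 x v * b.1 x w - a.1 x w * b.1 x v)).re)
    (fun v v' w => by
      simp only [map_add, add_mul, mul_add, map_sub, Complex.sub_re, Complex.add_re]
      ring)
    (fun c v w => by
      simp only [map_smul, smul_mul_assoc, mul_smul_comm, ← smul_sub, LinearMap.map_smul_of_tower,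
        Complex.smul_re, smul_neg])
    (fun v v' w => by
      simp only [map_add, add_mul, mul_add, map_sub, Complex.sub_re, Complex.add_re]
      ring)
    (fun c v w => by
      simp only [map_smul, smul_mul_assoc, mul_smul_comm, ← smul_sub, LinearMap.map_smul_of_tower,
        Complex.smul_re, smul_neg]))
    (fun v => by simp)

theorem traceWedge_eq_realTraceForm (a b : SHForm h) (x : X) (v : Fin 2 → RTan n x) :
    traceWedge a b x v = (-1 : ℂ) • (realTraceForm a b x v : ℂ) := by
  rw [traceWedge_apply]
  refine Complex.ext ?_ ?_
  · simp [realTraceForm, LinearMap.toAlternatingTwo_apply]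
  · simp [trace_mul_im]

theorem complexStructure_apply (a : SHForm h) (x : X) (v : RTan n x) :
    (complexStructure h a).1 x v = -a.1 x (tanJ x v) :=
  SHForm.complexStructure_eq a x v

theorem tanJ_tanJ (x : X) (v : RTan n x) : tanJ x (tanJ x v) = -v := by
  change Complex.I • Complex.I • (show Cn n from v) = -(show Cn n from v)
  rw [smul_smul, Complex.I_mul_I, neg_one_smul]

theorem complexStructure_sq (a : SHForm h) :
    complexStructure h (complexStructure h a) = -a := by
  ext x v : 3
  rw [complexStructure_apply, complexStructure_apply, tanJ_tanJ, map_neg, neg_neg]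
  rfl

/-- From `𝕁a = -a ∘ J` and `J² = -1` one gets `(𝕁a)(Jv) = a(v)`; both terms on the right are
nonnegative by skewness. -/
theorem realTraceForm_complexStructure (a : SHForm h) (x : X) (v : RTan n x) :
    realTraceForm a (complexStructure h a) x ![v, tanJ x v] =
      -(LinearMap.trace ℂ (E x) (a.1 x v * a.1 x v)).re
        - (LinearMap.trace ℂ (E x) (a.1 x (tanJ x v) * a.1 x (tanJ x v))).re := by
  change -(LinearMap.trace ℂ (E x) (a.1 x v * (complexStructure h a).1 x (tanJ x v) -
    a.1 x (tanJ x v) * (complexStructure h a).1 x v)).re = _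
  rw [complexStructure_apply, complexStructure_apply, tanJ_tanJ, map_neg, neg_neg, mul_neg,
    sub_neg_eq_add, map_add, Complex.add_re]
  ring

/-- Otherwise `a` would vanish on every `b l` and `J (b l)`, and these span the tangent space over
`ℝ`. -/
theorem exists_realTraceForm_pos {a : SHForm h} {x : X} {v₀ : RTan n x} (hv₀ : a.1 x v₀ ≠ 0)
    (b : Module.Basis (Fin n) ℂ (Cn n)) :
    ∃ l, 0 < realTraceForm a (complexStructure h a) x ![b l, tanJ x (b l)] := by
  by_contra! hb
  have h0 : ∀ l, a.1 x (b l) = 0 ∧ a.1 x (tanJ x (b l)) = 0 := by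
    intro l
    have h1 := (realTraceForm_complexStructure a x (b l)).symm.trans_le (hb l)
    have h2 := trace_sq_nonpos a x (b l)
    have h3 := trace_sq_nonpos a x (tanJ x (b l))
    constructor
    · by_contra hne
      have := trace_sq_neg a x hne
      linarith
    · by_contra hne
      have := trace_sq_neg a x hne
      linarith
  refine hv₀ ?_
  set v : Cn n := v₀
  have h1 : v = ∑ l, ((b.repr v l).re • b l + (b.repr v l).im • (Complex.I • b l)) := by
    conv_lhs => rw [← b.sum_repr v]
    refine Finset.sum_congr rfl fun l _ => ?_
    funext i
    simp only [Pi.smul_apply, Pi.add_apply, smul_eq_mul, Complex.real_smul]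
    conv_lhs => rw [← Complex.re_add_im (b.repr v l)]
    ring
  set f : Cn n →ₗ[ℝ] Module.End ℂ (E x) := a.1 x
  change f v = 0
  rw [h1, map_sum]
  refine Finset.sum_eq_zero fun l _ => ?_
  have h2 : f (b l) = 0 := (h0 l).1
  have h3 : f (Complex.I • b l) = 0 := (h0 l).2
  rw [map_add, map_smul, map_smul, h2, h3, smul_zero, smul_zero, add_zero]

theorem traceWedge_add_left (a a' b : SHForm h) (x : X) (v : Fin 2 → RTan n x) :
    traceWedge (a + a') b x v = traceWedge a b x v + traceWedge a' b x v := by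
  simp only [traceWedge_apply, ← map_add]
  congr 1
  simp only [Submodule.coe_add, Pi.add_apply, LinearMap.add_apply, add_mul]
  abel

theorem traceWedge_smul_left (c : ℝ) (a b : SHForm h) (x : X) (v : Fin 2 → RTan n x) :
    traceWedge (c • a) b x v = (c : ℂ) • traceWedge a b x v := by
  simp only [traceWedge_apply, ← map_smul]
  congr 1
  simp only [Submodule.coe_smul, Pi.smul_apply, LinearMap.smul_apply, smul_mul_assoc, smul_sub,
    Complex.coe_smul]

theorem traceWedge_swap (a b : SHForm h) (x : X) (v : Fin 2 → RTan n x) :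
    traceWedge b a x v = (-1 : ℂ) • traceWedge a b x v := by
  simp only [traceWedge_apply, map_sub]
  rw [LinearMap.trace_mul_comm ℂ (b.1 x (v 0)), LinearMap.trace_mul_comm ℂ (b.1 x (v 1))]
  simp

theorem traceWedge_complexStructure (a b : SHForm h) (x : X) (v : Fin 2 → RTan n x) :
    traceWedge (complexStructure h a) (complexStructure h b) x v =
      traceWedge a b x (fun i => tanJ x (v i)) := by
  simp only [traceWedge_apply, complexStructure_apply, neg_mul_neg]

theorem wedge_add_left {T R : Type*} [Ring R] [Algebra ℂ R] {p q : ℕ} (α α' : (Fin p → T) → R)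
    (β : (Fin q → T) → R) (v : Fin (p + q) → T) :
    wedge (fun w => α w + α' w) β v = wedge α β v + wedge α' β v := by
  unfold wedge
  simp only [add_mul, smul_add, Finset.sum_add_distrib]

variable [NeZero n] (κ : KahlerForm n X)

/-- The form `tr(a ∧ b) ∧ κ^{n-1}` of top degree. -/
def traceTop (a b : SHForm h) (x : X) (v : Fin (2 * n) → RTan n x) : ℂ :=
  wedge (traceWedge a b x) (wedgePow (fun w : Fin 2 → RTan n x => (κ.form x w : ℂ)) (n - 1))
    (fun i => v (Fin.cast (degree_eq₂ n) i))

theorem traceTop_add_left (a a' b : SHForm h) (x : X) (v : Fin (2 * n) → RTan n x) :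
    traceTop κ (a + a') b x v = traceTop κ a b x v + traceTop κ a' b x v := by
  unfold traceTop
  rw [← wedge_add_left]
  exact congrArg (fun α => wedge α _ _) (funext fun w => traceWedge_add_left a a' b x w)

theorem traceTop_smul_left (c : ℝ) (a b : SHForm h) (x : X) (v : Fin (2 * n) → RTan n x) :
    traceTop κ (c • a) b x v = (c : ℂ) * traceTop κ a b x v := by
  exact (congrArg (fun α => wedge α _ _) (funext fun w => traceWedge_smul_left c a b x w)).trans
    (wedge_const_smul_left _ _ _ _)

theorem traceTop_swap (a b : SHForm h) (x : X) (v : Fin (2 * n) → RTan n x) :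
    traceTop κ b a x v = (-1 : ℂ) * traceTop κ a b x v := by
  exact (congrArg (fun α => wedge α _ _) (funext fun w => traceWedge_swap a b x w)).trans
    (wedge_const_smul_left _ _ _ _)

theorem traceTop_eq (a b : SHForm h) (x : X) (v : Fin (2 * n) → RTan n x) :
    traceTop κ a b x v = (-1 : ℂ) * wedge (fun w => (realTraceForm a b x w : ℂ))
      (wedgePow (fun w : Fin 2 → RTan n x => (κ.form x w : ℂ)) (n - 1))
      (fun i => v (Fin.cast (degree_eq n) i)) := by
  exact (congrArg (fun α => wedge α _ _)
    (funext fun w => traceWedge_eq_realTraceForm a b x w)).trans (wedge_const_smul_left _ _ _ _)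

theorem traceTop_im (a b : SHForm h) (x : X) (v : Fin (2 * n) → RTan n x) :
    (traceTop κ a b x v).im = 0 := by
  obtain ⟨C, -, hC⟩ := wedge_wedgePow_eq (T := RTan n x) (n - 1)
  rw [traceTop_eq, hC, ← Complex.ofReal_one, ← Complex.ofReal_neg, ← Complex.ofReal_mul,
    Complex.ofReal_im]

/-- The two minus signs of `𝕁` cancel and `κ` is `J`-invariant, so both factors are evaluated on
vectors moved by `J`; a real top form does not change, because `|det J|² = |iⁿ|² = 1`. -/
theorem traceTop_complexStructure (a b : SHForm h) (x : X) (v : Fin (2 * n) → RTan n x) :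
    traceTop κ (complexStructure h a) (complexStructure h b) x v = traceTop κ a b x v := by
  have h1 : traceTop κ (complexStructure h a) (complexStructure h b) x v =
      traceTop κ a b x (fun i => tanJ x (v i)) := by
    have h2 : (fun w : Fin 2 → RTan n x => (κ.form x w : ℂ)) =
        fun w => (κ.form x (fun i => tanJ x (w i)) : ℂ) := by
      funext w
      have h3 : ∀ u : Fin 2 → RTan n x, u = ![u 0, u 1] := fun u => by
        funext i
        fin_cases i <;> rfl
      rw [h3 w, h3 fun i => _]
      exact congrArg _ (κ.invariant x (w 0) (w 1)).symm
    have h4 : (wedgePow (fun w : Fin 2 → RTan n x => (κ.form x w : ℂ)) (n - 1)) = fun w =>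
        wedgePow (fun w : Fin 2 → RTan n x => (κ.form x w : ℂ)) (n - 1)
          (fun i => tanJ x (w i)) := by
      conv_lhs => rw [h2]
      exact funext fun w => wedgePow_comp (fun u => tanJ x u)
        (fun w : Fin 2 → RTan n x => (κ.form x w : ℂ)) (n - 1) w
    have h5 : traceWedge (complexStructure h a) (complexStructure h b) x = fun w =>
        traceWedge a b x (fun i => tanJ x (w i)) :=
      funext fun w => traceWedge_complexStructure a b x w
    unfold traceTop
    rw [h5]
    conv_lhs => rw [h4]
    rfl
  rw [h1]
  refine Complex.ext ?_ ((traceTop_im κ a b x _).trans (traceTop_im κ a b x _).symm)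
  obtain ⟨γ, hγ⟩ := exists_topForm (realTraceForm a b x) (κ.form x).toAlternatingMap
  have h6 : ∀ v : Fin (2 * n) → RTan n x, (traceTop κ a b x v).re = -γ v := fun v => by
    rw [traceTop_eq, neg_one_mul, Complex.neg_re]
    exact congrArg Neg.neg (hγ v).symm
  rw [h6, h6]
  have h7 := γ.map_complexLinear (by simp) (Complex.I • LinearMap.id) v
  rw [LinearMap.det_smul, LinearMap.det_id, mul_one, map_pow, Complex.normSq_I, one_pow,
    one_mul] at h7
  exact congrArg Neg.neg h7

theorem realTop_nonneg (a : SHForm h) (i : X) {y : Cn n}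
    (hy : y ∈ (extChartAt 𝓘(ℝ, Cn n) i).target) :
    (traceTop κ a (complexStructure h a) (chartParam n i y)
      (fun k => chartParamDeriv n i y (stdFrame n k))).re ≤ 0 ∧
    ((∃ v, a.1 (chartParam n i y) v ≠ 0) →
      (traceTop κ a (complexStructure h a) (chartParam n i y)
        (fun k => chartParamDeriv n i y (stdFrame n k))).re < 0) := by
  set x := chartParam n i y with hx
  -- The tangent space at `x` is `Cn n` by definition, so the differential of the chart is a
  -- complex-linear endomorphism to which the frame lemmas apply.
  have hD : ∃ D : Cn n →ₗ[ℂ] Cn n, ∀ v, D v = chartParamDeriv n i y v := by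
    refine ⟨{ toFun := chartParamDeriv n i y, map_add' := map_add _, map_smul' := fun c v => ?_ },
      fun v => rfl⟩
    have h1 : ∀ v : Cn n, c • v = c.re • v + c.im • (Complex.I • v) := fun v => by
      funext i
      simp only [Pi.smul_apply, Pi.add_apply, smul_eq_mul, Complex.real_smul]
      conv_lhs => rw [← Complex.re_add_im c]
      ring
    set f : Cn n →L[ℝ] Cn n := chartParamDeriv n i y
    have h2 : f (Complex.I • v) = Complex.I • f v := chartParamDeriv_I_smul hy v
    change f (c • v) = c • f v
    rw [h1 v, map_add, map_smul, map_smul, h2, ← h1]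
  obtain ⟨D, hD⟩ := hD
  have hDi : Function.Injective D := fun v w hvw => by
    rw [hD, hD] at hvw
    exact chartParamDeriv_injective hy hvw
  have hβ : ∀ v : Cn n, 0 ≤ realTraceForm a (complexStructure h a) x ![v, Complex.I • v] :=
    fun v => by
      have h1 := realTraceForm_complexStructure a x v
      have h2 := trace_sq_nonpos a x v
      have h3 := trace_sq_nonpos a x (tanJ x v)
      refine le_trans ?_ h1.ge
      linarith
  rw [traceTop_eq, neg_one_mul, Complex.neg_re, neg_nonpos, neg_lt_zero]
  refine ⟨?_, ?_⟩
  · have h1 := topForm_nonneg (β := realTraceForm a (complexStructure h a) x)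
      (κ := (κ.form x).toAlternatingMap) (κ.invariant x) (κ.positive x) hβ D
    simp only [hD] at h1
    exact h1
  · rintro ⟨v, hv⟩
    have h1 := topForm_pos (β := realTraceForm a (complexStructure h a) x)
      (κ := (κ.form x).toAlternatingMap) (κ.invariant x) (κ.positive x) hβ D hDi
      (exists_realTraceForm_pos hv)
    simp only [hD] at h1
    exact h1

variable [T2Space X] [CompactSpace X]

theorem traceIntegral_eq (a b : SHForm h) : traceIntegral κ a b = integralTop (traceTop κ a b) :=
  rfl

theorem continuousTop_traceTop (a b : SHForm h) : ContinuousTop (traceTop κ a b) :=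
  fun i => continuousOn_topForm κ a b i

theorem traceIntegral_im (a b : SHForm h) : (traceIntegral κ a b).im = 0 :=
  integralTop_im (continuousTop_traceTop κ a b) (traceTop_im κ a b)

theorem traceIntegral_add_left (a a' b : SHForm h) :
    traceIntegral κ (a + a') b = traceIntegral κ a b + traceIntegral κ a' b := by
  rw [traceIntegral_eq, traceIntegral_eq, traceIntegral_eq,
    ← integralTop_add (continuousTop_traceTop κ a b) (continuousTop_traceTop κ a' b)]
  exact congrArg _ (funext fun x => funext fun v => traceTop_add_left κ a a' b x v)

theorem traceIntegral_smul_left (c : ℝ) (a b : SHForm h) :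
    traceIntegral κ (c • a) b = c * traceIntegral κ a b := by
  rw [traceIntegral_eq, traceIntegral_eq, ← integralTop_const_mul]
  exact congrArg _ (funext fun x => funext fun v => traceTop_smul_left κ c a b x v)

theorem traceIntegral_swap (a b : SHForm h) : traceIntegral κ b a = -traceIntegral κ a b := by
  rw [← neg_one_mul, traceIntegral_eq, traceIntegral_eq, ← integralTop_const_mul]
  exact congrArg _ (funext fun x => funext fun v => traceTop_swap κ a b x v)

theorem traceIntegral_complexStructure (a b : SHForm h) :
    traceIntegral κ (complexStructure h a) (complexStructure h b) = traceIntegral κ a b := by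
  rw [traceIntegral_eq, traceIntegral_eq]
  exact congrArg _ (funext fun x => funext fun v => traceTop_complexStructure κ a b x v)

theorem traceIntegral_complexStructure_neg {a : SHForm h} (ha : a ≠ 0) :
    (traceIntegral κ a (complexStructure h a)).re < 0 := by
  obtain ⟨x₀, v₀, hv₀⟩ : ∃ x v, a.1 x v ≠ 0 := by
    by_contra! h0
    exact ha (Subtype.ext (funext fun x => LinearMap.ext fun v => h0 x v))
  -- The sign is changed inside the first argument, so that the positivity criterion for integrals
  -- applies to a form of the same kind.
  have hc : ContinuousTop (traceTop κ ((-1 : ℝ) • a) (complexStructure h a)) :=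
    continuousTop_traceTop κ _ _
  have hneg : ∀ x v, traceTop κ ((-1 : ℝ) • a) (complexStructure h a) x v =
      -traceTop κ a (complexStructure h a) x v := fun x v => by
    rw [traceTop_smul_left, Complex.ofReal_neg, Complex.ofReal_one, neg_one_mul]
  have h1 := integralTop_re_pos hc (fun i y hy => by
      rw [hneg, Complex.neg_re, neg_nonneg]
      exact (realTop_nonneg κ a i hy).1) x₀ (fun i y hy hxy => by
      rw [hneg, Complex.neg_re, neg_pos]
      refine (realTop_nonneg κ a i hy).2 ?_
      rw [hxy]
      exact ⟨v₀, hv₀⟩)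
  rw [← traceIntegral_eq, traceIntegral_smul_left, Complex.re_ofReal_mul] at h1
  linarith

/-- The Atiyah–Bott form `-(1/8π²) ∫_X tr(a ∧ b) ∧ κ^{n-1}`. -/
def atiyahBottForm : SHForm h [⋀^Fin 2]→ₗ[ℝ] ℝ :=
  LinearMap.toAlternatingTwo (LinearMap.mk₂ ℝ
    (fun (a b : SHForm h) => -(1 / (8 * Real.pi ^ 2)) * (traceIntegral κ a b).re)
    (fun (a a' b : SHForm h) => by rw [traceIntegral_add_left, Complex.add_re, mul_add])
    (fun (c : ℝ) (a b : SHForm h) => by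
      rw [traceIntegral_smul_left, Complex.re_ofReal_mul, smul_eq_mul]
      ring)
    (fun (a b b' : SHForm h) => by
      rw [traceIntegral_swap κ _ a, traceIntegral_add_left, traceIntegral_swap κ a b,
        traceIntegral_swap κ a b']
      simp only [Complex.add_re, Complex.neg_re]
      ring)
    (fun (c : ℝ) (a b : SHForm h) => by
      rw [traceIntegral_swap κ _ a, traceIntegral_smul_left, traceIntegral_swap κ a b,
        Complex.neg_re, Complex.re_ofReal_mul, Complex.neg_re, smul_eq_mul]
      ring))
    (fun (a : SHForm h) => by
      have h1 : traceIntegral κ a a = 0 := self_eq_neg.1 (traceIntegral_swap κ a a)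
      simp [h1])

theorem atiyahBottForm_apply (a b : SHForm h) :
    atiyahBottForm κ ![a, b] = -(1 / (8 * Real.pi ^ 2)) * (traceIntegral κ a b).re := rfl

theorem atiyahBottForm_eq (a b : SHForm h) :
    (atiyahBottForm κ ![a, b] : ℂ) = -(1 / (8 * (Real.pi : ℂ) ^ 2)) * traceIntegral κ a b := by
  have h1 : ((traceIntegral κ a b).re : ℂ) = traceIntegral κ a b :=
    Complex.ext (Complex.ofReal_re _) ((Complex.ofReal_im _).trans (traceIntegral_im κ a b).symm)
  rw [atiyahBottForm_apply, Complex.ofReal_mul, h1]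
  push_cast
  rfl

end AtiyahBott

/-! ### The theorem. -/

theorem mainTheorem7 {n : ℕ} [NeZero n] {X : Type*} [TopologicalSpace X] [T2Space X]
    [CompactSpace X] [ChartedSpace (Cn n) X] [IsManifold 𝓘(ℂ, Cn n) ∞ X] (κ : KahlerForm n X)
    {F : Type*} [NormedAddCommGroup F] [NormedSpace ℂ F] [FiniteDimensional ℂ F]
    {E : X → Type*} [∀ x, AddCommGroup (E x)] [∀ x, Module ℂ (E x)]
    [∀ x, TopologicalSpace (E x)] [∀ x, IsTopologicalAddGroup (E x)]
    [∀ x, ContinuousSMul ℝ (E x)] [TopologicalSpace (TotalSpace F E)] [FiberBundle F E]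
    [VectorBundle ℂ F E] [VectorBundle ℝ F E] [ContMDiffVectorBundle ∞ F E 𝓘(ℝ, Cn n)]
    (h : HermitianMetric n F E) :
    ∃ K : UnitaryConnection h → SHForm h [⋀^Fin 2]→ₗ[ℝ] ℝ,
      (∀ (A : UnitaryConnection h) (a b : SHForm h),
        (K A ![a, b] : ℂ) = -(1 / 2) * fibreChernForm κ A ![a, b]) ∧
      (∀ (A : UnitaryConnection h) (a b : SHForm h),
        (K A ![a, b] : ℂ) = -(1 / (8 * (Real.pi : ℂ) ^ 2)) * traceIntegral κ a b) ∧
      IsKahlerForm (𝒜 := UnitaryConnection h) (T := SHForm h) (complexStructure h) K := by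
  refine ⟨fun _ => atiyahBottForm κ, fun A a b => ?_, fun _ a b => atiyahBottForm_eq κ a b, ?_⟩
  · rw [fibreChernForm_eq, atiyahBottForm_eq]
    ring
  -- The form is constant along the affine space, so all its derivatives vanish.
  · refine ⟨complexStructure_sq, fun _ _ _ _ => contDiff_const, fun _ _ _ _ => ?_,
      fun _ a b => ?_, fun _ a ha => ?_⟩
    · simp only [deriv_const, sub_zero, add_zero]
    · rw [atiyahBottForm_apply, atiyahBottForm_apply, traceIntegral_complexStructure]
    · rw [atiyahBottForm_apply]
      exact mul_pos_of_neg_of_neg (neg_neg_of_pos (by positivity))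
        (traceIntegral_complexStructure_neg κ ha)
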